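/- Universality of the 3-local railroad-switch Hamiltonian $H_{3S}^{\circ}$. Let $C$ be a non-empty circuit on $n$ qubits consisting of $L_1$ one-qubit gates and $L_{CNOT}$ CNOTs, with unitary $U=U_G\cdots U_1$, $G=L_1+L_{CNOT}$. Put $M=L_1+3L_{CNOT}$, pad $C$ with $2M$ identity gates $U_{G+1},\dots,U_P$ ($P=G+2M$), and let $N=6M$. The system consists of the $n$ work qubits, of clock qubits $c_0,\dots,c_P$ and $c_{0'},\dots,c_{P'}$ with $c_{0'}=c_0$ and $c_{P'}=c_P$, and, for each CNOT and each of the two copies of the line, of four more clock qubits $u_1,u_2,l_1,l_2$. For clock qubits $a,b$ write $|a\rangle\langle a|$ for $|1\rangle\langle1|_a$ and $|b\rangle\langle a|$ for $|01\rangle\langle10|_{a,b}$, and for a unitary $V$ on the work qubits let $$h_V(a,b)=\tfrac12\big(|a\rangle\langle a|+|b\rangle\langle b|-V\otimes|b\rangle\langle a|-V^\dagger\otimes|a\rangle\langle b|\big).$$ $H_{3S}^{\circ}$ is the sum, over both copies of the line and all steps $t=1,\dots,P$, of the term $h_{U_t}(c_{t-1},c_t)$ if $U_t$ is a one-qubit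 or padding gate, and of the six terms $$|1\rangle\langle1|_{q_1}h_{1}(c_{t-1},u_1),\quad h_{\sigma^x_{q_2}}(u_1,u_2),\quad |1\rangle\langle1|_{q_1}h_{1}(u_2,c_t),$$ $$|0\rangle\langle0|_{q_1}h_{1}(c_{t-1},l_1),\quad h_{1}(l_1,l_2),\quad |0\rangle\langle0|_{q_1}h_{1}(l_2,c_t)$$ if $U_t$ is a CNOT with control $q_1$ and target $q_2$. Let $\varphi_0$ be any unit vector of the work register (for example $|0\cdots0\rangle$), $\varphi_t=U_t\cdots U_1\varphi_0$, and let $|a\rangle$ be the clock state in which $a$ is the only clock qubit in state $1$. The legal states are, in both copies of the line, $\varphi_t\otimes|c_t\rangle$ and, for each CNOT at a step $t$, $$P_0\varphi_{t-1}\otimes|l_1\rangle+P_1\varphi_{t-1}\otimes|u_1\rangle,\qquad P_0\varphi_{t-1}\otimes|l_2\rangle+\sigma^x_{q_2}P_1\varphi_{t-1}\otimes|u_2\rangle,$$ where $P_k=|k\rangle\langle k|_{q_1}$. They are arranged on a cycle: the unprimed copy forwards from $c_0$ to $c_P$, then the primed copy backwards. Let $\mathcal H_{legal}^{\circ}$ be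 their span. 1. There are $n+6L_1+22L_{CNOT}$ qubits and $6L_1+24L_{CNOT}$ terms. Every term is a projector and is 3-local, and the Hamiltonian is frustration-free: every term annihilates the unit vector $N^{-1/2}\sum_p\psi_p$, the sum running over the legal states. 2. $H_{3S}^{\circ}$ leaves $\mathcal H_{legal}^{\circ}$, which contains $\varphi_0\otimes|c_0\rangle$, and its orthogonal complement invariant. The legal states are an orthonormal basis of $\mathcal H_{legal}^{\circ}$, there are $N$ of them, and in this basis, numbered along the cycle, the restriction of $H_{3S}^{\circ}$ is $I-\tfrac12B_\circ$, with $B_\circ$ the adjacency matrix of the cycle of length $N$. 3. Let $\psi(\tau)=e^{-i\tau H_{3S}^{\circ}}(\varphi_0\otimes|c_0\rangle)$. The success region is the set of clock qubits at least $M$ clock steps (a third of the padded line) away from $c_0$, where a CNOT counts three steps. Let $p(\tau)$ be the probability to find, when the clock of $\psi(\tau)$ is measured, a qubit of the success region in state $1$; $p$ is a continuous function of $\tau$. For every $\tau\in\mathbb R$, the projection of $\psi(\tau)$ onto these outcomes is a product of $U\varphi_0$ on the work register with a vector of the clock register. For $\tau$ uniformly random in $[0,T]$, write $\bar p_T=\frac1T\int_0^Tp(\tau)\,d\tau$.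 There is an absolute constant $K>0$ such that for all $n$, $C$, $\varphi_0$ as above and all $T>0$ $$\frac23-\frac1{3N}-K\frac{N\log^2N}{T}\le\bar p_T\le\frac23+\frac2{3N}+K\frac{N\log^2N}{T}.$$ Consequently a running time $O(N\log^2N)$, $N=6(L_1+3L_{CNOT})$, suffices: for every $\varepsilon>0$ there is $K_\varepsilon>0$, independent of $n$, $C$ and $\varphi_0$, such that $|\bar p_T-\frac23|\le\varepsilon+\frac2{3N}$ for all $T\ge K_\varepsilon N\log^2N$. -/

import Mathlib

open scoped Matrix

namespace RailroadSwitch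

noncomputable section

/-! ### Registers of qubits -/

/-- Vectors of a register whose qubits are labelled by `Q`; the computational basis states are
the bit assignments `Q → Fin 2`. -/
abbrev StateVec (Q : Type) : Type := (Q → Fin 2) → ℂ

/-- Operators on such a register, as matrices in the computational basis. -/
abbrev Operator (Q : Type) : Type := Matrix (Q → Fin 2) (Q → Fin 2) ℂ

/-- The one-qubit operator `A` applied to qubit `q`, tensored with the identity elsewhere. -/
def onQubit {Q : Type} [Fintype Q] [DecidableEq Q] (q : Q) (A : Matrix (Fin 2) (Fin 2) ℂ) :
    Operator Q :=
  Matrix.of fun x y => if ∀ r, r ≠ q → x r = y r then A (x q) (y q) else 0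

/-- `A` acts nontrivially on at most `k` qubits: it is `a ⊗ 1` for an operator `a` on a set `S` of
at most `k` qubits. -/
def IsLocal {Q : Type} [Fintype Q] [DecidableEq Q] (k : ℕ) (A : Operator Q) : Prop :=
  ∃ (S : Finset Q) (a : Operator S), S.card ≤ k ∧
    ∀ x y, A x y = if ∀ q, q ∉ S → x q = y q then a (fun q => x q) (fun q => y q) else 0

/-- The one-qubit operator `|i⟩⟨j|`. -/
def ketbra (i j : Fin 2) : Matrix (Fin 2) (Fin 2) ℂ := Matrix.single i j 1

/-- The bit flip `σˣ`. -/
def pauliX : Matrix (Fin 2) (Fin 2) ℂ := ketbra 0 1 + ketbra 1 0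

/-! ### Circuits -/

/-- Gates on `n` work qubits: arbitrary one-qubit unitaries, and CNOTs. -/
inductive Gate (n : ℕ) : Type
  | single (q : Fin n) (U : Matrix.unitaryGroup (Fin 2) ℂ) : Gate n
  | cnot (control target : Fin n) (distinct : control ≠ target) : Gate n

/-- A circuit; the head of the list is the gate applied first. -/
abbrev Circuit (n : ℕ) : Type := List (Gate n)

namespace Gate

variable {n : ℕ}

def isCnot : Gate n → Bool
  | single _ _ => false
  | cnot _ _ _ => true

def control : (g : Gate n) → g.isCnot = true → Fin n
  | cnot c _ _, _ => c

def target : (g : Gate n) → g.isCnot = true → Fin n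
  | cnot _ t _, _ => t

def qubit : (g : Gate n) → g.isCnot = false → Fin n
  | single q _, _ => q

def matrix : (g : Gate n) → g.isCnot = false → Matrix (Fin 2) (Fin 2) ℂ
  | single _ U, _ => U.1

/-- The unitary of a gate on the work register. -/
def op : Gate n → Operator (Fin n)
  | single q U => onQubit q U.1
  | cnot c t _ => onQubit c (ketbra 0 0) + onQubit c (ketbra 1 1) * onQubit t pauliX

/-- The number of clock steps a gate takes: one for a one-qubit gate, three for a CNOT. -/
def duration : Gate n → ℕ
  | single _ _ => 1
  | cnot _ _ _ => 3

end Gate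

section Construction

variable {n : ℕ} (C : Circuit n)

/-- The number of one-qubit gates. -/
def numSingle : ℕ := C.countP (fun g => !g.isCnot)

/-- The number of CNOT gates. -/
def numCnot : ℕ := C.countP (fun g => g.isCnot)

/-- The unitary `U = U_L ⋯ U_1` of the circuit. -/
def circuitUnitary : Operator (Fin n) := C.foldl (fun V g => g.op * V) 1

/-- The number of clock steps of the computation proper, `L₁ + 3 L_CNOT`. -/
def computationTime : ℕ := numSingle C + 3 * numCnot C

/-- The number of gates of the circuit padded with `2 (L₁ + 3 L_CNOT)` identity gates, which makes
the line of clock steps three times longer. -/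
def paddedLength : ℕ := C.length + 2 * computationTime C

/-- The length `2 · 3 (L₁ + 3 L_CNOT)` of the cycle of clock steps. -/
def cycleLength : ℕ := 2 * (3 * computationTime C)

/-- `φ_t`, the work register after the first `t` gates of the padded circuit. -/
def workState (φ₀ : StateVec (Fin n)) : ℕ → StateVec (Fin n)
  | 0 => φ₀
  | t + 1 =>
    match C[t]? with
    | some g => g.op *ᵥ workState φ₀ t
    | none => workState φ₀ t

/-- The number of clock steps from `c_0` to the main station `c_t` along the padded line. -/
def lineTime (t : ℕ) : ℕ :=
  ∑ s ∈ Finset.range t, match C[s]? with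
    | some g => g.duration
    | none => 1

/-! ### The clock register -/

/-- The main stations `c_0, …, c_P` and `c_{0'}, …, c_{P'}` of the doubled clock (the primed copy
is flagged `true`), with `c_{0'}` identified with `c_0` and `c_{P'}` with `c_P`: the identified
stations are represented in the unprimed copy only. -/
abbrev Station : Type :=
  {s : Bool × Fin (paddedLength C + 1) //
    s.1 = true → s.2 ≠ 0 ∧ s.2 ≠ Fin.last (paddedLength C)}

/-- The positions of the CNOT gates. -/
abbrev SwitchStep : Type := {t : Fin C.length // C[t].isCnot = true}

/-- The positions of the one-qubit gates. -/
abbrev SingleStep : Type := {t : Fin C.length // C[t].isCnot = false}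

/-- The clock qubits: the main stations and, for each CNOT in each copy of the line, four more.
`(b, s, k, i)` is on the track taken when the control qubit is `k` (so `k = 1` is the upper track,
`k = 0` the lower one), at position `i`: `u₁, u₂` are `(b, s, 1, 0), (b, s, 1, 1)` and
`l₁, l₂` are `(b, s, 0, 0), (b, s, 0, 1)`. -/
abbrev ClockQubit : Type := Station C ⊕ (Bool × SwitchStep C × Fin 2 × Fin 2)

instance : DecidableEq (ClockQubit C) := inferInstance

/-- All the qubits: work qubits and clock qubits. -/
abbrev Qubit : Type := Fin n ⊕ ClockQubit C

/-- The main station `c_t` (for `b = false`) or `c_{t'}` (for `b = true`). -/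
def station (b : Bool) (t : Fin (paddedLength C + 1)) : ClockQubit C :=
  if h : t = 0 ∨ t = Fin.last (paddedLength C) then
    Sum.inl ⟨(false, t), by simp⟩
  else
    Sum.inl ⟨(b, t), fun _ => not_or.mp h⟩

/-- The rail qubit `(b, s, k, i)` of a switch. -/
def rail (b : Bool) (s : SwitchStep C) (k i : Fin 2) : ClockQubit C := Sum.inr (b, s, k, i)

/-- The station at which the train is before gate `t` of the circuit. -/
def before (b : Bool) (t : Fin C.length) : ClockQubit C :=
  station C b ⟨t, by unfold paddedLength; omega⟩

/-- The station at which the train is after gate `t` of the circuit. -/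
def after (b : Bool) (t : Fin C.length) : ClockQubit C :=
  station C b ⟨t + 1, by unfold paddedLength; omega⟩

/-! ### The Hamiltonian -/

/-- `|b⟩⟨a|` on the clock: the train moves from clock qubit `a` to clock qubit `b`,
that is `|01⟩⟨10|` on the pair `(a, b)`. -/
def hop (a b : ClockQubit C) : Operator (Qubit C) :=
  onQubit (Sum.inr a) (ketbra 0 1) * onQubit (Sum.inr b) (ketbra 1 0)

/-- `|a⟩⟨a|` on the clock, implemented as `|1⟩⟨1|` on clock qubit `a`. -/
def active (a : ClockQubit C) : Operator (Qubit C) := onQubit (Sum.inr a) (ketbra 1 1)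

/-- `½ (|a⟩⟨a| + |b⟩⟨b| - V ⊗ |b⟩⟨a| - V† ⊗ |a⟩⟨b|)`, for `V` acting on the work qubits. -/
def transition (V : Operator (Qubit C)) (a b : ClockQubit C) : Operator (Qubit C) :=
  (1 / 2 : ℂ) • (active C a + active C b - V * hop C a b - Vᴴ * hop C b a)

/-- The term of a one-qubit gate. -/
def singleTerm (b : Bool) (s : SingleStep C) : Operator (Qubit C) :=
  transition C (onQubit (Sum.inl (C[s.1].qubit s.2)) (C[s.1].matrix s.2))
    (before C b s.1) (after C b s.1)

/-- The term of the `j`-th padding identity gate. -/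
def idleTerm (b : Bool) (j : Fin (2 * computationTime C)) : Operator (Qubit C) :=
  transition C 1
    (station C b ⟨C.length + j, by unfold paddedLength; omega⟩)
    (station C b ⟨C.length + j + 1, by unfold paddedLength; omega⟩)

/-- The three terms of track `k` of a railroad switch: `k = 1` gives `H_up`, `k = 0` gives
`H_lo`. -/
def switchTerm (b : Bool) (s : SwitchStep C) (k : Fin 2) : Fin 3 → Operator (Qubit C)
  | 0 => onQubit (Sum.inl (C[s.1].control s.2)) (ketbra k k) *
      transition C 1 (before C b s.1) (rail C b s k 0)
  | 1 => transition C (if k = 1 then onQubit (Sum.inl (C[s.1].target s.2)) pauliX else 1)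
      (rail C b s k 0) (rail C b s k 1)
  | 2 => onQubit (Sum.inl (C[s.1].control s.2)) (ketbra k k) *
      transition C 1 (rail C b s k 1) (after C b s.1)

/-- Labels of the terms: a copy of the line, and then a one-qubit gate, a padding gate, or one of
the six pieces of a switch. -/
abbrev TermLabel : Type :=
  Bool × (SingleStep C ⊕ Fin (2 * computationTime C) ⊕ (SwitchStep C × Fin 2 × Fin 3))

/-- The terms of the Hamiltonian. -/
def term : TermLabel C → Operator (Qubit C)
  | (b, Sum.inl s) => singleTerm C b s
  | (b, Sum.inr (Sum.inl j)) => idleTerm C b j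
  | (b, Sum.inr (Sum.inr (s, k, i))) => switchTerm C b s k i

/-- The Hamiltonian `H_{3S}^∘`. -/
def hamiltonian : Operator (Qubit C) := ∑ i, term C i

/-! ### The legal subspace -/

/-- The state `φ ⊗ |a⟩`: work register in state `φ`, and clock qubit `a` the only one that
is `1`. -/
def withTrain (φ : StateVec (Fin n)) (a : ClockQubit C) : StateVec (Qubit C) :=
  fun x => if (fun c => x (Sum.inr c)) = Pi.single a 1 then φ (fun q => x (Sum.inl q)) else 0

/-- Labels of the legal states: main stations, and, for each CNOT in each copy of the line, the
two intermediate states `ψ^{(1)}` (for `0`) and `ψ^{(2)}` (for `1`). -/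
abbrev Place : Type := Station C ⊕ (Bool × SwitchStep C × Fin 2)

/-- The legal states: `φ_t ⊗ |c_t⟩` at the stations (in both copies of the line), and inside a
switch, with `φ_t = a |0⟩α + b |1⟩β` split according to the control qubit,
`ψ^{(1)} = a |0⟩α ⊗ |l₁⟩ + b |1⟩β ⊗ |u₁⟩` and
`ψ^{(2)} = a |0⟩α ⊗ |l₂⟩ + b σˣ_target |1⟩β ⊗ |u₂⟩`. -/
def legalState (φ₀ : StateVec (Fin n)) : Place C → StateVec (Qubit C)
  | Sum.inl s => withTrain C (workState C φ₀ s.1.2) (Sum.inl s)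
  | Sum.inr (b, s, i) =>
    let lower := onQubit (C[s.1].control s.2) (ketbra 0 0) *ᵥ workState C φ₀ s.1
    let upper := onQubit (C[s.1].control s.2) (ketbra 1 1) *ᵥ workState C φ₀ s.1
    withTrain C lower (rail C b s 0 i) +
      withTrain C (if i = 0 then upper else onQubit (C[s.1].target s.2) pauliX *ᵥ upper)
        (rail C b s 1 i)

/-- The legal subspace. -/
def legalSubspace (φ₀ : StateVec (Fin n)) : Submodule ℂ (StateVec (Qubit C)) :=
  Submodule.span ℂ (Set.range (legalState C φ₀))

/-- The uniform superposition of the legal states. -/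
def historyState (φ₀ : StateVec (Fin n)) : StateVec (Qubit C) :=
  ((1 / Real.sqrt (cycleLength C) : ℝ) : ℂ) • ∑ p, legalState C φ₀ p

/-- The position of a legal state on the cycle of clock steps: the unprimed copy is run through
forwards, from `0` to half the cycle, and the primed copy then backwards. -/
def cyclePosition : Place C → ℕ
  | Sum.inl s => if s.1.1 then cycleLength C - lineTime C s.1.2 else lineTime C s.1.2
  | Sum.inr (b, s, i) =>
    if b then cycleLength C - (lineTime C s.1 + 1 + i) else lineTime C s.1 + 1 + i

/-! ### Time evolution and measurement -/

/-- The initial state `φ₀ ⊗ |c_0⟩`. -/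
def startState (φ₀ : StateVec (Fin n)) : StateVec (Qubit C) := withTrain C φ₀ (station C false 0)

/-- The state `exp(-i τ H) (φ₀ ⊗ |c_0⟩)` at time `τ`. -/
def evolved (φ₀ : StateVec (Fin n)) (τ : ℝ) : StateVec (Qubit C) :=
  NormedSpace.exp ((-(Complex.I * τ)) • hamiltonian C) *ᵥ startState C φ₀

/-- The distance of a clock qubit from `c_0`, in clock steps. -/
def distanceFromStart : ClockQubit C → ℕ
  | Sum.inl s => lineTime C s.1.2
  | Sum.inr (_, s, _, i) => lineTime C s.1 + 1 + i

/-- The success region: the clock qubits at least a third of the padded line away from `c_0`. -/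
def InSuccessRegion (a : ClockQubit C) : Prop := computationTime C ≤ distanceFromStart C a

/-- The measurement outcomes in which some clock qubit of the success region is found active. -/
def SuccessOutcome (x : Qubit C → Fin 2) : Prop :=
  ∃ a : ClockQubit C, InSuccessRegion C a ∧ x (Sum.inr a) = 1

open Classical in
/-- The probability to find an active clock qubit in the success region at time `τ`. -/
def successProbability (φ₀ : StateVec (Fin n)) (τ : ℝ) : ℝ :=
  ∑ x : Qubit C → Fin 2, if SuccessOutcome C x then ‖evolved C φ₀ τ x‖ ^ 2 else 0

/-- The success probability at a time chosen uniformly at random in `[0, T]`. -/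
def averageSuccess (φ₀ : StateVec (Fin n)) (T : ℝ) : ℝ :=
  (1 / T) * ∫ τ in (0 : ℝ)..T, successProbability C φ₀ τ

end Construction

end

end RailroadSwitch

namespace RailroadSwitch

/-! ### Operators on single qubits -/

section OnQubit

variable {Q : Type} [Fintype Q] [DecidableEq Q]

/-! On legal states the Hamiltonian is half the graph Laplacian of a cycle. A term sees a one-train
state only if the train stands on one of its two clock qubits, and the two ends then give opposite
multiples of one vector (`term_mulVec_withTrain`, `term_mulVec_legalState`). The coefficients are
incidence numbers of an edge; those of one edge sum to zero, so every term kills the history state.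
For a switch, the vectors of the two tracks add up to half a difference of neighbouring legal states
(`sum_departure_switch`), because the control projectors are complete and the flipped branches
recombine to the output of the CNOT. Numbering places and edges by residues mod `N` turns the sum
over edges into the free walk `hamiltonian_mulVec_cycleState`.

Plane waves diagonalise that walk with energies `1 - cos (2πk/N)`. The averaged probability of a
region `S` is a double sum over momenta `k`, `l` of a phase average times a character sum over `S`
(`average_walkProbability`). Energies coincide exactly when `k = ±l`; these pairs contribute a value
computed by counting (`sum_stationary`), here `2/3 + 2/(3N) - 2/N²`.

For the other pairs, write `chord d = |χ d - 1|`. The energy gap factors as `chord (k-l) * chord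
(k+l) / 2`, the phase average is at most `2/(T·gap)`, and the character sum over an interval is at
most `2 / chord (k-l)`. In the variables `k-l` and `k+l` the double sum is bounded by a product
(`sum_sub_add_le`): `∑ chord⁻²` is `O(N²)` and `∑ chord⁻¹` is `O(N log N)`. After division by `N²`
the error is `O(N log N / T)`, which implies the stated bound.

Finally, the success region starts only after every gate of the circuit has acted, so its stations
all carry `U φ₀` and no rail belongs to it (`exists_evolved_eq_mul`). -/

lemma onQubit_mulVec (q : Q) (A : Matrix (Fin 2) (Fin 2) ℂ) (v : StateVec Q) (x : Q → Fin 2) :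
    (onQubit q A *ᵥ v) x = ∑ j, A (x q) j * v (Function.update x q j) := by
  symm
  refine Finset.sum_of_injOn (fun j => Function.update x q j)
    (Function.update_injective x q).injOn (fun _ _ => Finset.mem_coe.2 (Finset.mem_univ _)) ?_ ?_
  · intro y _ hy
    have : ¬ ∀ r, r ≠ q → x r = y r := by
      intro h
      refine hy ⟨y q, by simp, ?_⟩
      funext r
      by_cases hr : r = q
      · subst hr; simp
      · simp [hr, h r hr]
    simp [onQubit, this]
  · intro j _
    have : ∀ r, r ≠ q → x r = Function.update x q j r := by
      intro r hr; simp [hr]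
    simp only [onQubit, Matrix.of_apply, if_pos this, Function.update_self]

lemma onQubit_mul_apply (q : Q) (A : Matrix (Fin 2) (Fin 2) ℂ) (B : Operator Q)
    (x y : Q → Fin 2) :
    (onQubit q A * B) x y = ∑ j, A (x q) j * B (Function.update x q j) y :=
  onQubit_mulVec q A (fun z => B z y) x

lemma operator_ext {A B : Operator Q} (h : ∀ v, A *ᵥ v = B *ᵥ v) : A = B :=
  Matrix.mulVec_injective (funext h)

lemma onQubit_mul (q : Q) (A B : Matrix (Fin 2) (Fin 2) ℂ) :
    onQubit q A * onQubit q B = onQubit q (A * B) := by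
  refine operator_ext fun v => funext fun x => ?_
  rw [← Matrix.mulVec_mulVec]
  simp only [onQubit_mulVec, Function.update_self, Function.update_idem, Matrix.mul_apply,
    Finset.mul_sum, Finset.sum_mul]
  rw [Finset.sum_comm]
  simp only [mul_assoc]

lemma onQubit_commute {q r : Q} (h : q ≠ r) (A B : Matrix (Fin 2) (Fin 2) ℂ) :
    Commute (onQubit q A) (onQubit r B) := by
  refine operator_ext fun v => funext fun x => ?_
  rw [← Matrix.mulVec_mulVec, ← Matrix.mulVec_mulVec]
  simp only [onQubit_mulVec, Finset.mul_sum, Function.update_of_ne h, Function.update_of_ne h.symm]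
  rw [Finset.sum_comm]
  refine Finset.sum_congr rfl fun i _ => Finset.sum_congr rfl fun j _ => ?_
  rw [Function.update_comm h]
  ring

lemma onQubit_one (q : Q) : onQubit q 1 = 1 := by
  refine operator_ext fun v => funext fun x => ?_
  simp [onQubit_mulVec, Matrix.one_apply]

lemma onQubit_zero (q : Q) : onQubit q 0 = 0 := by
  ext; simp [onQubit]

lemma onQubit_add (q : Q) (A B : Matrix (Fin 2) (Fin 2) ℂ) :
    onQubit q (A + B) = onQubit q A + onQubit q B := by
  ext x y; simp only [onQubit, Matrix.of_apply, Matrix.add_apply]; split_ifs <;> simp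

lemma onQubit_sub (q : Q) (A B : Matrix (Fin 2) (Fin 2) ℂ) :
    onQubit q (A - B) = onQubit q A - onQubit q B := by
  ext x y; simp only [onQubit, Matrix.of_apply, Matrix.sub_apply]; split_ifs <;> simp

lemma onQubit_conjTranspose (q : Q) (A : Matrix (Fin 2) (Fin 2) ℂ) :
    (onQubit q A)ᴴ = onQubit q Aᴴ := by
  ext x y
  have : (∀ r, r ≠ q → y r = x r) ↔ ∀ r, r ≠ q → x r = y r := by simp only [eq_comm]
  simp only [onQubit, Matrix.conjTranspose_apply, Matrix.of_apply, this]
  split_ifs <;> simp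

lemma ketbra_conjTranspose (i j : Fin 2) : (ketbra i j)ᴴ = ketbra j i := by
  simp [ketbra]

lemma ketbra_mul (i j k : Fin 2) : ketbra i j * ketbra j k = ketbra i k := by
  simp [ketbra]

lemma ketbra_mul_of_ne {j k : Fin 2} (i l : Fin 2) (h : j ≠ k) : ketbra i j * ketbra k l = 0 := by
  simp [ketbra, h]

lemma ketbra_add : ketbra 0 0 + ketbra 1 1 = 1 := by
  ext i j; fin_cases i <;> fin_cases j <;> simp [ketbra, Matrix.single]

lemma ketbra_zero_zero : ketbra 0 0 = 1 - ketbra 1 1 := by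
  rw [← ketbra_add]; simp

lemma pauliX_conjTranspose : pauliXᴴ = pauliX := by
  simp [pauliX, ketbra_conjTranspose, add_comm]

lemma pauliX_mul_self : pauliX * pauliX = 1 := by
  ext i j; fin_cases i <;> fin_cases j <;> simp [pauliX, ketbra, Matrix.single, Matrix.mul_apply]

lemma isStarProjection_onQubit (q : Q) (k : Fin 2) :
    IsStarProjection (onQubit q (ketbra k k)) where
  isIdempotentElem := by rw [IsIdempotentElem, onQubit_mul, ketbra_mul]
  isSelfAdjoint := by
    rw [IsSelfAdjoint, Matrix.star_eq_conjTranspose, onQubit_conjTranspose, ketbra_conjTranspose]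

lemma sum_onQubit_ketbra (q : Q) : ∑ k, onQubit q (ketbra k k) = 1 := by
  rw [Fin.sum_univ_two, ← onQubit_add, ketbra_add, onQubit_one]

/-! ### Locality through commutation -/

/-- `A` commutes with every operator on a qubit outside of `S`. -/
def ActsWithin (S : Finset Q) (A : Operator Q) : Prop :=
  ∀ q, q ∉ S → ∀ B, Commute A (onQubit q B)

lemma mul_onQubit_ketbra_apply (A : Operator Q) (q : Q) (i j : Fin 2) (x y : Q → Fin 2) :
    (A * onQubit q (ketbra i j)) x y = if y q = j then A x (Function.update y q i) else 0 := by
  have h : (A * onQubit q (ketbra i j)) = (onQubit q (ketbra j i) * Aᴴ)ᴴ := by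
    rw [Matrix.conjTranspose_mul, onQubit_conjTranspose, ketbra_conjTranspose,
      Matrix.conjTranspose_conjTranspose]
  rw [h, Matrix.conjTranspose_apply, onQubit_mul_apply]
  by_cases hj : y q = j
  · simp [ketbra, Matrix.single_apply, hj]
  · simp [ketbra, hj, Ne.symm hj]

lemma onQubit_ketbra_mul_apply (A : Operator Q) (q : Q) (i j : Fin 2) (x y : Q → Fin 2) :
    (onQubit q (ketbra i j) * A) x y = if x q = i then A (Function.update x q j) y else 0 := by
  rw [onQubit_mul_apply]
  simp [ketbra, Matrix.single_apply, ite_and, eq_comm]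

lemma ActsWithin.apply_eq_zero {S : Finset Q} {A : Operator Q} (h : ActsWithin S A) {q : Q}
    (hq : q ∉ S) {x y : Q → Fin 2} (hxy : x q ≠ y q) : A x y = 0 := by
  have := congrFun (congrFun (h q hq (ketbra (x q) (x q))) x) y
  rw [mul_onQubit_ketbra_apply, onQubit_ketbra_mul_apply] at this
  simpa [hxy.symm] using this.symm

/-- Comparing one matrix entry of the commutation with `|i⟩⟨j|` shows that the value of a spectator
qubit, equal on both sides, is irrelevant. -/
lemma ActsWithin.apply_update {S : Finset Q} {A : Operator Q} (h : ActsWithin S A) {q : Q}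
    (hq : q ∉ S) (i j : Fin 2) (x y : Q → Fin 2) :
    A (Function.update x q i) (Function.update y q i) =
      A (Function.update x q j) (Function.update y q j) := by
  have := congrFun (congrFun (h q hq (ketbra i j)) (Function.update x q i))
    (Function.update y q j)
  rw [mul_onQubit_ketbra_apply, onQubit_ketbra_mul_apply] at this
  simpa using this

/-- Commuting with all one-qubit operators outside `S` forces the form `a ⊗ 1`. Entries vanish when
a spectator qubit changes, and otherwise do not depend on the spectators, so `a` can be read off
with all of them set to `0`. -/
lemma ActsWithin.isLocal {S : Finset Q} {A : Operator Q} (h : ActsWithin S A) :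
    IsLocal S.card A := by
  let ext : (S → Fin 2) → Q → Fin 2 := fun u q => if hq : q ∈ S then u ⟨q, hq⟩ else 0
  refine ⟨S, Matrix.of fun u v => A (ext u) (ext v), le_rfl, fun x y => ?_⟩
  split_ifs with hxy
  -- The spectators are reset to `0` one at a time; taking `T = Sᶜ` resets them all.
  · have key : ∀ T : Finset Q, Disjoint T S → A x y =
        A (fun q => if q ∈ T then 0 else x q) (fun q => if q ∈ T then 0 else y q) := by
      intro T
      induction T using Finset.induction_on with
      | empty => simp
      | insert q T hqT ih =>
        intro hd
        rw [Finset.disjoint_insert_left] at hd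
        rw [ih hd.2]
        have e : ∀ z : Q → Fin 2, (fun r => if r ∈ insert q T then 0 else z r) =
            Function.update (fun r => if r ∈ T then 0 else z r) q 0 := by
          intro z; funext r
          by_cases hr : r = q
          · subst hr; simp
          · simp [hr]
        have e' : ∀ z : Q → Fin 2, (fun r => if r ∈ T then 0 else z r) =
            Function.update (fun r => if r ∈ T then 0 else z r) q (z q) := by
          intro z; funext r
          by_cases hr : r = q
          · subst hr; simp [hqT]
          · simp [hr]
        rw [e x, e y]
        conv_lhs => rw [e' x, e' y, ← hxy q hd.1]
        exact h.apply_update hd.1 _ _ _ _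
    have e : ∀ z : Q → Fin 2, (fun q => if q ∈ Sᶜ then 0 else z q) = ext fun q => z q := by
      intro z; funext q
      by_cases hq : q ∈ S <;> simp [ext, hq]
    rw [key Sᶜ disjoint_compl_left, e, e, Matrix.of_apply]
  · push Not at hxy
    obtain ⟨q, hq, hne⟩ := hxy
    exact h.apply_eq_zero hq hne

lemma IsLocal.mono {k l : ℕ} (hkl : k ≤ l) {A : Operator Q} (h : IsLocal k A) : IsLocal l A := by
  obtain ⟨S, a, hS, h⟩ := h
  exact ⟨S, a, hS.trans hkl, h⟩

lemma actsWithin_onQubit {S : Finset Q} {q : Q} (hq : q ∈ S) (A : Matrix (Fin 2) (Fin 2) ℂ) :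
    ActsWithin S (onQubit q A) :=
  fun _ hr _ => onQubit_commute (ne_of_mem_of_not_mem hq hr) _ _

lemma actsWithin_one (S : Finset Q) : ActsWithin S (1 : Operator Q) :=
  fun _ _ _ => Commute.one_left _

lemma ActsWithin.mul {S : Finset Q} {A B : Operator Q} (hA : ActsWithin S A)
    (hB : ActsWithin S B) : ActsWithin S (A * B) :=
  fun q hq D => (hA q hq D).mul_left (hB q hq D)

lemma ActsWithin.add {S : Finset Q} {A B : Operator Q} (hA : ActsWithin S A)
    (hB : ActsWithin S B) : ActsWithin S (A + B) :=
  fun q hq D => (hA q hq D).add_left (hB q hq D)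

lemma ActsWithin.sub {S : Finset Q} {A B : Operator Q} (hA : ActsWithin S A)
    (hB : ActsWithin S B) : ActsWithin S (A - B) :=
  fun q hq D => (hA q hq D).sub_left (hB q hq D)

lemma ActsWithin.smul {S : Finset Q} {A : Operator Q} (c : ℂ) (hA : ActsWithin S A) :
    ActsWithin S (c • A) :=
  fun q hq D => (hA q hq D).smul_left c

end OnQubit

/-! ### Transition terms -/

/-- Here `X` and `Y` are the two hops. The product `a * b` is not zero, since both clock qubits may
be `1`; the square of `a + b` contributes `2ab`, which the `-2ab` in `X * Y + Y * X` cancels. Hence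
idempotence holds on the whole space, not only for one train. -/
lemma isIdempotentElem_half_transition {R : Type*} [Ring R] [Algebra ℂ R] {a b X Y : R}
    (haa : a * a = a) (hbb : b * b = b) (hba : b * a = a * b)
    (haX : a * X = 0) (hbX : b * X = X) (hXa : X * a = X) (hXb : X * b = 0)
    (haY : a * Y = Y) (hbY : b * Y = 0) (hYa : Y * a = 0) (hYb : Y * b = Y)
    (hXX : X * X = 0) (hYY : Y * Y = 0) (hXY : X * Y = b - a * b) (hYX : Y * X = a - a * b) :
    IsIdempotentElem ((1 / 2 : ℂ) • (a + b - X - Y)) := by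
  have h : (a + b - X - Y) * (a + b - X - Y) = (2 : ℂ) • (a + b - X - Y) := by
    simp only [sub_mul, mul_sub, add_mul, mul_add, haa, hbb, hba, haX, hbX, hXa, hXb, haY, hbY,
      hYa, hYb, hXX, hYY, hXY, hYX]
    module
  rw [IsIdempotentElem, smul_mul_smul_comm, h, smul_smul]
  norm_num

section

variable {Q : Type} [Fintype Q] [DecidableEq Q]

lemma onQubit_pair_mul {a b : Q} (hab : a ≠ b) (A B A' B' : Matrix (Fin 2) (Fin 2) ℂ) :
    (onQubit a A * onQubit b B) * (onQubit a A' * onQubit b B') =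
      onQubit a (A * A') * onQubit b (B * B') := by
  rw [← onQubit_mul, ← onQubit_mul, mul_assoc, ← mul_assoc _ _ (onQubit _ B'),
    (onQubit_commute hab.symm B A').eq]
  simp only [mul_assoc]

/-- Moving `V` and `W` to the front leaves products of operators on the two clock qubits, and each
relation reduces to multiplying ketbras on each qubit separately. -/
lemma isIdempotentElem_transition {a b : Q} (hab : a ≠ b) {V W : Operator Q}
    (hVa : ∀ A, Commute V (onQubit a A)) (hVb : ∀ A, Commute V (onQubit b A))
    (hWa : ∀ A, Commute W (onQubit a A)) (hWb : ∀ A, Commute W (onQubit b A))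
    (h1 : W * V = 1) (h2 : V * W = 1) :
    IsIdempotentElem ((1 / 2 : ℂ) • (onQubit a (ketbra 1 1) + onQubit b (ketbra 1 1) -
      V * (onQubit a (ketbra 0 1) * onQubit b (ketbra 1 0)) -
      W * (onQubit a (ketbra 1 0) * onQubit b (ketbra 0 1)))) := by
  have norm := onQubit_pair_mul hab
  have ea : onQubit a (ketbra 1 1) = onQubit a (ketbra 1 1) * onQubit b 1 := by
    rw [onQubit_one, mul_one]
  have eb : onQubit b (ketbra 1 1) = onQubit a 1 * onQubit b (ketbra 1 1) := by
    rw [onQubit_one, one_mul]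
  have k01 : ∀ i l, ketbra i 0 * ketbra 1 l = 0 := fun i l => ketbra_mul_of_ne i l (by decide)
  have k10 : ∀ i l, ketbra i 1 * ketbra 0 l = 0 := fun i l => ketbra_mul_of_ne i l (by decide)
  have comp : ∀ {V W A B g : Operator Q}, Commute W A → Commute W B →
      V * (A * B) * (W * g) = V * W * ((A * B) * g) := by
    intro V W A B g hA hB
    rw [mul_assoc, ← mul_assoc (A * B), ← (hA.mul_right hB).eq]; simp only [mul_assoc]
  have left : ∀ {V a h : Operator Q}, Commute V a → a * (V * h) = V * (a * h) := by
    intro V a h hc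
    rw [← mul_assoc, ← hc.eq, mul_assoc]
  have hba : onQubit b (ketbra 1 1) * onQubit a (ketbra 1 1) =
      onQubit a (ketbra 1 1) * onQubit b (ketbra 1 1) := (onQubit_commute hab.symm _ _).eq
  have hXY : (onQubit a (ketbra 0 1) * onQubit b (ketbra 1 0)) *
      (onQubit a (ketbra 1 0) * onQubit b (ketbra 0 1)) =
      onQubit b (ketbra 1 1) - onQubit a (ketbra 1 1) * onQubit b (ketbra 1 1) := by
    rw [norm, ketbra_mul, ketbra_mul, ketbra_zero_zero, onQubit_sub, onQubit_one, sub_mul, one_mul]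
  have hYX : (onQubit a (ketbra 1 0) * onQubit b (ketbra 0 1)) *
      (onQubit a (ketbra 0 1) * onQubit b (ketbra 1 0)) =
      onQubit a (ketbra 1 1) - onQubit a (ketbra 1 1) * onQubit b (ketbra 1 1) := by
    rw [norm, ketbra_mul, ketbra_mul, ketbra_zero_zero, onQubit_sub, onQubit_one, mul_sub, mul_one]
  refine isIdempotentElem_half_transition ?_ ?_ hba ?_ ?_ ?_ ?_ ?_ ?_ ?_ ?_ ?_ ?_ ?_ ?_
  · rw [onQubit_mul, ketbra_mul]
  · rw [onQubit_mul, ketbra_mul]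
  · rw [left (hVa _), ea, norm, k10, onQubit_zero, zero_mul, mul_zero]
  · rw [left (hVb _), eb, norm, ketbra_mul, one_mul]
  · rw [mul_assoc, ea, norm, ketbra_mul, mul_one]
  · rw [mul_assoc, eb, norm, k01, onQubit_zero, mul_zero, mul_zero]
  · rw [left (hWa _), ea, norm, ketbra_mul, one_mul]
  · rw [left (hWb _), eb, norm, k10, onQubit_zero, mul_zero, mul_zero]
  · rw [mul_assoc, ea, norm, k01, onQubit_zero, zero_mul, mul_zero]
  · rw [mul_assoc, eb, norm, ketbra_mul, mul_one]
  · rw [comp (hVa _) (hVb _), norm, k10, onQubit_zero, zero_mul, mul_zero]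
  · rw [comp (hWa _) (hWb _), norm, k01, onQubit_zero, zero_mul, mul_zero]
  · rw [comp (hWa _) (hWb _), h2, one_mul, hXY]
  · rw [comp (hVa _) (hVb _), h1, one_mul, hYX]

end

section Transition

variable {n : ℕ} (C : Circuit n)

lemma hop_conjTranspose {a b : ClockQubit C} (hab : a ≠ b) : (hop C a b)ᴴ = hop C b a := by
  have : (Sum.inr a : Qubit C) ≠ Sum.inr b := by simpa using hab
  rw [hop, hop, Matrix.conjTranspose_mul, onQubit_conjTranspose, onQubit_conjTranspose,
    ketbra_conjTranspose, ketbra_conjTranspose]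

/-- An operator of the work register: it commutes with all operators of the clock. -/
def OnWork (V : Operator (Qubit C)) : Prop :=
  ∀ c B, Commute V (onQubit (Sum.inr c) B)

lemma onWork_onQubit (q : Fin n) (A : Matrix (Fin 2) (Fin 2) ℂ) :
    OnWork C (onQubit (Sum.inl q) A) :=
  fun _ _ => onQubit_commute Sum.inl_ne_inr _ _

lemma onWork_one : OnWork C 1 := fun _ _ => Commute.one_left _

lemma OnWork.conjTranspose {V : Operator (Qubit C)} (hV : OnWork C V) : OnWork C Vᴴ := by
  intro c B
  have := (hV c Bᴴ).star_star
  rwa [Matrix.star_eq_conjTranspose, Matrix.star_eq_conjTranspose, onQubit_conjTranspose,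
    Matrix.conjTranspose_conjTranspose] at this

lemma OnWork.hop {V : Operator (Qubit C)} (hV : OnWork C V) (a b : ClockQubit C) :
    Commute V (hop C a b) :=
  (hV a _).mul_right (hV b _)

lemma OnWork.active {V : Operator (Qubit C)} (hV : OnWork C V) (a : ClockQubit C) :
    Commute V (active C a) :=
  hV a _

variable {C} in
lemma isStarProjection_transition {V : Operator (Qubit C)} (hV : OnWork C V)
    (h1 : Vᴴ * V = 1) (h2 : V * Vᴴ = 1) {a b : ClockQubit C} (hab : a ≠ b) :
    IsStarProjection (transition C V a b) := by
  have hab' : (Sum.inr a : Qubit C) ≠ Sum.inr b := by simpa using hab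
  have hW := hV.conjTranspose
  refine ⟨?_, ?_⟩
  · have eh : hop C b a = onQubit (Sum.inr a) (ketbra 1 0) * onQubit (Sum.inr b) (ketbra 0 1) :=
      (onQubit_commute hab'.symm _ _).eq
    rw [transition, eh]
    exact isIdempotentElem_transition hab' (hV a) (hV b) (hW a) (hW b) h1 h2
  · rw [IsSelfAdjoint, Matrix.star_eq_conjTranspose, transition, Matrix.conjTranspose_smul,
      Matrix.conjTranspose_sub, Matrix.conjTranspose_sub, Matrix.conjTranspose_add,
      Matrix.conjTranspose_mul, Matrix.conjTranspose_mul, Matrix.conjTranspose_conjTranspose,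
      hop_conjTranspose C hab, hop_conjTranspose C hab.symm, ← (hV.hop C a b).eq,
      ← (hW.hop C b a).eq, sub_right_comm]
    have act : ∀ c, (active C c)ᴴ = active C c := fun c =>
      (isStarProjection_onQubit (Sum.inr c : Qubit C) 1).isSelfAdjoint
    rw [act, act]
    simp

variable {C} in
lemma actsWithin_transition {S : Finset (Qubit C)} {V : Operator (Qubit C)} {a b : ClockQubit C}
    (hV : ActsWithin S V) (hV' : ActsWithin S Vᴴ) (ha : Sum.inr a ∈ S) (hb : Sum.inr b ∈ S) :
    ActsWithin S (transition C V a b) :=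
  .smul _ <| .sub (.sub (.add (actsWithin_onQubit ha _) (actsWithin_onQubit hb _))
    (hV.mul (.mul (actsWithin_onQubit ha _) (actsWithin_onQubit hb _))))
    (hV'.mul (.mul (actsWithin_onQubit hb _) (actsWithin_onQubit ha _)))

end Transition

/-! ### Gates -/

namespace Gate

variable {n : ℕ}

lemma op_of_single (g : Gate n) (h : g.isCnot = false) :
    g.op = onQubit (g.qubit h) (g.matrix h) := by
  cases g with
  | single q U => rfl
  | cnot c t d => simp [isCnot] at h

lemma matrix_star_mul (g : Gate n) (h : g.isCnot = false) : (g.matrix h)ᴴ * g.matrix h = 1 := by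
  cases g with
  | single q U => exact Matrix.mem_unitaryGroup_iff'.1 U.2
  | cnot c t d => simp [isCnot] at h

lemma matrix_mul_star (g : Gate n) (h : g.isCnot = false) : g.matrix h * (g.matrix h)ᴴ = 1 := by
  cases g with
  | single q U => exact Matrix.mem_unitaryGroup_iff.1 U.2
  | cnot c t d => simp [isCnot] at h

lemma control_ne_target (g : Gate n) (h : g.isCnot = true) : g.control h ≠ g.target h := by
  cases g with
  | single q U => simp [isCnot] at h
  | cnot c t d => exact d

/-- The control projector is placed on the right, in the order of a train that first chooses its
track and then flips the target. -/
lemma op_of_cnot (g : Gate n) (h : g.isCnot = true) :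
    g.op = onQubit (g.control h) (ketbra 0 0) +
      onQubit (g.target h) pauliX * onQubit (g.control h) (ketbra 1 1) := by
  cases g with
  | single q U => simp [isCnot] at h
  | cnot c t d => rw [(onQubit_commute (control_ne_target (.cnot c t d) h).symm _ _).eq]; rfl

lemma op_star_mul (g : Gate n) : g.opᴴ * g.op = 1 := by
  by_cases h : g.isCnot = true
  · have hc := onQubit_commute (g.control_ne_target h)
    have X : onQubit (g.target h) pauliX * onQubit (g.target h) pauliX = 1 := by
      rw [onQubit_mul, pauliX_mul_self, onQubit_one]
    rw [op_of_cnot g h, Matrix.conjTranspose_add, Matrix.conjTranspose_mul,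
      onQubit_conjTranspose, onQubit_conjTranspose, onQubit_conjTranspose, ketbra_conjTranspose,
      ketbra_conjTranspose, pauliX_conjTranspose, mul_add, add_mul, add_mul, onQubit_mul,
      ketbra_mul, mul_assoc, ← (hc (ketbra 0 0) _).eq, ← mul_assoc (onQubit (g.control h) _),
      onQubit_mul, ketbra_mul_of_ne _ _ (by decide : (1 : Fin 2) ≠ 0), onQubit_zero, zero_mul,
      ← mul_assoc (onQubit (g.control h) _), (hc (ketbra 0 0) _).eq, mul_assoc, onQubit_mul,
      ketbra_mul_of_ne _ _ (by decide : (0 : Fin 2) ≠ 1), onQubit_zero, mul_zero,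
      mul_assoc (onQubit (g.control h) _), ← mul_assoc (onQubit (g.target h) _), X, one_mul,
      onQubit_mul, ketbra_mul, add_zero, zero_add, ← onQubit_add, ketbra_add, onQubit_one]
  · have h : g.isCnot = false := by simpa using h
    rw [op_of_single g h, onQubit_conjTranspose, onQubit_mul, matrix_star_mul, onQubit_one]

end Gate

section

variable {n : ℕ} (C : Circuit n)

lemma workState_succ (φ₀ : StateVec (Fin n)) (t : Fin C.length) :
    workState C φ₀ (t + 1) = C[t].op *ᵥ workState C φ₀ t := by
  rw [workState]; simp

lemma workState_succ_of_le (φ₀ : StateVec (Fin n)) {t : ℕ} (ht : C.length ≤ t) :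
    workState C φ₀ (t + 1) = workState C φ₀ t := by
  rw [workState, List.getElem?_eq_none ht]

lemma star_mulVec_dotProduct {m : Type} [Fintype m] [DecidableEq m] {A : Matrix m m ℂ}
    (hA : Aᴴ * A = 1) (v w : m → ℂ) : star (A *ᵥ v) ⬝ᵥ (A *ᵥ w) = star v ⬝ᵥ w := by
  rw [Matrix.star_mulVec, Matrix.dotProduct_mulVec, Matrix.vecMul_vecMul, hA, Matrix.vecMul_one]

lemma star_workState_dotProduct (φ₀ : StateVec (Fin n)) (t : ℕ) :
    star (workState C φ₀ t) ⬝ᵥ workState C φ₀ t = star φ₀ ⬝ᵥ φ₀ := by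
  induction t with
  | zero => rfl
  | succ t ih =>
    by_cases h : t < C.length
    · rw [workState_succ C φ₀ ⟨t, h⟩, star_mulVec_dotProduct (Gate.op_star_mul _), ih]
    · rw [workState_succ_of_le C φ₀ (not_lt.1 h), ih]

/-! ### States with one train -/

variable (φ ψ : StateVec (Fin n)) (a b c : ClockQubit C)

lemma withTrain_add : withTrain C (φ + ψ) a = withTrain C φ a + withTrain C ψ a := by
  funext x; simp only [withTrain, Pi.add_apply]; split_ifs <;> simp

lemma withTrain_zero : withTrain C 0 a = 0 := by
  funext x; simp [withTrain]

lemma withTrain_sum {ι : Type*} (s : Finset ι) (f : ι → StateVec (Fin n)) :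
    withTrain C (∑ i ∈ s, f i) a = ∑ i ∈ s, withTrain C (f i) a := by
  induction s using Finset.cons_induction with
  | empty => simp [withTrain_zero]
  | cons i s hi ih => rw [Finset.sum_cons, Finset.sum_cons, withTrain_add, ih]

/-- The basis splits into work and clock assignments, and a one-train state lives on a single clock
assignment. -/
lemma star_withTrain_dotProduct :
    star (withTrain C φ a) ⬝ᵥ withTrain C ψ b = if a = b then star φ ⬝ᵥ ψ else 0 := by
  simp only [dotProduct]
  rw [← (Equiv.sumArrowEquivProdArrow (Fin n) (ClockQubit C) (Fin 2)).symm.sum_comp,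
    Fintype.sum_prod_type]
  split_ifs with h
  · subst h
    refine Finset.sum_congr rfl fun x _ => ?_
    rw [Finset.sum_eq_single (Pi.single a 1 : ClockQubit C → Fin 2)]
    · simp [withTrain, Equiv.sumArrowEquivProdArrow]
    · intro y _ hy
      simp [withTrain, Equiv.sumArrowEquivProdArrow, hy]
    · simp
  · refine Finset.sum_eq_zero fun x _ => Finset.sum_eq_zero fun y _ => ?_
    have : (Pi.single a 1 : ClockQubit C → Fin 2) ≠ Pi.single b 1 := by
      intro e
      have := congrFun e a
      simp [h] at this
    by_cases hy : y = Pi.single a 1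
    · simp [withTrain, Equiv.sumArrowEquivProdArrow, hy, this]
    · simp [withTrain, Equiv.sumArrowEquivProdArrow, hy]

lemma active_mulVec_withTrain :
    active C a *ᵥ withTrain C φ c = if c = a then withTrain C φ c else 0 := by
  funext x
  rw [active, onQubit_mulVec]
  have : ∀ i j, ketbra 1 1 i j = if i = 1 ∧ j = 1 then 1 else 0 := by
    intro i j; simp [ketbra, Matrix.single_apply, eq_comm]
  simp only [this, ite_and, Fin.sum_univ_two]
  by_cases hx : x (Sum.inr a) = 1
  · have e : Function.update x (Sum.inr a) 1 = x := by rw [← hx, Function.update_eq_self]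
    by_cases hc : c = a
    · simp [hx, hc, e]
    · have : (fun c => x (Sum.inr c)) ≠ Pi.single c 1 := by
        intro e
        have := congrFun e a
        simp [hx, Ne.symm hc] at this
      have : withTrain C φ c x = 0 := if_neg this
      simp [hx, hc, e, this]
  · by_cases hc : c = a
    · subst hc
      have : (fun c => x (Sum.inr c)) ≠ Pi.single c 1 := by
        intro e
        exact hx (by simpa using congrFun e c)
      simp [hx, withTrain, this]
    · simp [hx, hc]

lemma hop_mulVec_withTrain {a b : ClockQubit C} (hab : a ≠ b) :
    hop C a b *ᵥ withTrain C φ c = if c = a then withTrain C φ b else 0 := by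
  funext x
  have hab' : (Sum.inr a : Qubit C) ≠ Sum.inr b := by simpa using hab
  rw [hop, ← Matrix.mulVec_mulVec]
  simp only [onQubit_mulVec, Function.update_of_ne hab'.symm]
  have k01 : ∀ i j, ketbra 0 1 i j = if i = 0 then if j = 1 then 1 else 0 else 0 := by
    intro i j; simp [ketbra, Matrix.single_apply, eq_comm, ite_and]
  have k10 : ∀ i j, ketbra 1 0 i j = if i = 1 then if j = 0 then 1 else 0 else 0 := by
    intro i j; simp [ketbra, Matrix.single_apply, eq_comm, ite_and]
  simp only [k01, k10]
  by_cases hxa : x (Sum.inr a) = 0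
  · by_cases hxb : x (Sum.inr b) = 1
    · simp only [hxa, hxb, if_true, ite_mul, one_mul, zero_mul, Finset.sum_ite_eq',
        Finset.mem_univ]
      -- Undoing the hop: the assignment with `a` set to `1` and `b` to `0` is the one-train
      -- assignment of `c` exactly when `c = a` and the given assignment has its train at `b`.
      have key : (fun r => Function.update (Function.update x (Sum.inr a) 1) (Sum.inr b) 0
          (Sum.inr r)) = Pi.single c 1 ↔ c = a ∧ (fun r => x (Sum.inr r)) = Pi.single b 1 := by
        constructor
        · intro e
          have hc : c = a := by
            have := congrFun e a
            by_contra h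
            simp [Function.update_of_ne hab', Ne.symm h] at this
          refine ⟨hc, ?_⟩
          funext r
          by_cases hra : r = a
          · subst hra; simp [hxa, hab]
          · by_cases hrb : r = b
            · subst hrb; simp [hxb]
            · have := congrFun e r
              simpa [Function.update_of_ne, hra, hrb, hc] using this
        · rintro ⟨rfl, e⟩
          funext r
          by_cases hra : r = c
          · subst hra; simp [Function.update_of_ne hab']
          · by_cases hrb : r = b
            · subst hrb; simp [hra]
            · have := congrFun e r
              simpa [Function.update_of_ne, hra, hrb] using this
      have e : (fun q => Function.update (Function.update x (Sum.inr a) 1) (Sum.inr b) 0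
          (Sum.inl q)) = fun q => x (Sum.inl q) := by
        funext q; simp [Function.update_of_ne]
      rw [withTrain, if_congr key rfl rfl, e]
      by_cases hc : c = a <;> simp [withTrain, hc]
    · have : (fun r => x (Sum.inr r)) ≠ Pi.single b 1 := by
        intro e
        exact hxb (by simpa using congrFun e b)
      by_cases hc : c = a <;> simp [hxb, withTrain, this, hc]
  · have : (fun r => x (Sum.inr r)) ≠ Pi.single b 1 := by
      intro e
      exact hxa (by simpa [hab] using congrFun e a)
    by_cases hc : c = a <;> simp [hxa, withTrain, this, hc]

lemma onQubit_mulVec_withTrain (q : Fin n) (A : Matrix (Fin 2) (Fin 2) ℂ) :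
    onQubit (Sum.inl q) A *ᵥ withTrain C φ c = withTrain C (onQubit q A *ᵥ φ) c := by
  funext x
  have : ∀ j, (fun r => Function.update x (Sum.inl q) j (Sum.inl r)) =
      Function.update (fun r => x (Sum.inl r)) q j := by
    intro j; funext r
    by_cases h : r = q
    · subst h; simp
    · simp [h]
  simp only [onQubit_mulVec, withTrain, Function.update_of_ne Sum.inr_ne_inl, this]
  split_ifs <;> simp

/-- `V` acts on states with one train as `W` on the work register. -/
def Lifts (V : Operator (Qubit C)) (W : Operator (Fin n)) : Prop :=
  ∀ φ c, V *ᵥ withTrain C φ c = withTrain C (W *ᵥ φ) c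

lemma lifts_onQubit (q : Fin n) (A : Matrix (Fin 2) (Fin 2) ℂ) :
    Lifts C (onQubit (Sum.inl q) A) (onQubit q A) :=
  fun _ _ => onQubit_mulVec_withTrain _ _ _ _ _

lemma lifts_one : Lifts C 1 1 := fun _ _ => by simp

lemma transition_mulVec_withTrain {V : Operator (Qubit C)} {W W' : Operator (Fin n)}
    (hV : Lifts C V W) (hV' : Lifts C Vᴴ W') {a b : ClockQubit C} (hab : a ≠ b) :
    transition C V a b *ᵥ withTrain C φ c =
      (1 / 2 : ℂ) • ((if c = a then withTrain C φ a - withTrain C (W *ᵥ φ) b else 0) +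
        if c = b then withTrain C φ b - withTrain C (W' *ᵥ φ) a else 0) := by
  rw [transition, Matrix.smul_mulVec, Matrix.sub_mulVec, Matrix.sub_mulVec, Matrix.add_mulVec,
    ← Matrix.mulVec_mulVec, ← Matrix.mulVec_mulVec, hop_mulVec_withTrain C _ _ hab,
    hop_mulVec_withTrain C _ _ hab.symm, active_mulVec_withTrain, active_mulVec_withTrain]
  congr 1
  by_cases hca : c = a
  · subst hca
    simp [hab, hV φ b]
  · by_cases hcb : c = b
    · subst hcb
      simp [hca, hV' φ a]
    · simp [hca, hcb]

end

noncomputable section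

variable {n : ℕ} (C : Circuit n)

/-! ### Stations, rails and edges of the line -/

/-- The main station `station C b t`, as a `Station`. -/
def stationOf (b : Bool) (t : Fin (paddedLength C + 1)) : Station C :=
  if h : t = 0 ∨ t = Fin.last (paddedLength C) then ⟨(false, t), by simp⟩
  else ⟨(b, t), fun _ => not_or.mp h⟩

lemma station_eq (b : Bool) (t : Fin (paddedLength C + 1)) :
    station C b t = Sum.inl (stationOf C b t) := by
  unfold station stationOf; split_ifs <;> rfl

lemma stationOf_snd (b : Bool) (t : Fin (paddedLength C + 1)) : (stationOf C b t).1.2 = t := by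
  unfold stationOf; split_ifs <;> rfl

lemma station_ne {b b' : Bool} {t t' : Fin (paddedLength C + 1)} (h : (t : ℕ) ≠ t') :
    station C b t ≠ station C b' t' := by
  rw [station_eq, station_eq]
  intro e
  have := congrArg (fun s : Station C => (s.1.2 : ℕ)) (Sum.inl.inj e)
  simp only [stationOf_snd] at this
  exact h this

lemma station_ne_rail (b b' : Bool) (t : Fin (paddedLength C + 1)) (s : SwitchStep C)
    (k i : Fin 2) : station C b t ≠ rail C b' s k i := by
  rw [station_eq]; exact Sum.inl_ne_inr

/-- The place of a clock qubit: the two tracks of a switch are identified. -/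
def placeOf : ClockQubit C → Place C
  | Sum.inl t => Sum.inl t
  | Sum.inr (b, s, _, i) => Sum.inr (b, s, i)

/-- The edges of one copy of the line. -/
abbrev LineEdge : Type := SingleStep C ⊕ Fin (2 * computationTime C) ⊕ (SwitchStep C × Fin 3)

/-- The clock qubit which the term `i` leaves. -/
def termSource : TermLabel C → ClockQubit C
  | (b, Sum.inl s) => before C b s.1
  | (b, Sum.inr (Sum.inl j)) => station C b ⟨C.length + j, by unfold paddedLength; omega⟩
  | (b, Sum.inr (Sum.inr (s, k, i))) =>
    match i with
    | 0 => before C b s.1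
    | 1 => rail C b s k 0
    | 2 => rail C b s k 1

/-- The clock qubit which the term `i` reaches. -/
def termTarget : TermLabel C → ClockQubit C
  | (b, Sum.inl s) => after C b s.1
  | (b, Sum.inr (Sum.inl j)) => station C b ⟨C.length + j + 1, by unfold paddedLength; omega⟩
  | (b, Sum.inr (Sum.inr (s, k, i))) =>
    match i with
    | 0 => rail C b s k 0
    | 1 => rail C b s k 1
    | 2 => after C b s.1

/-- The first end of an edge. -/
def edgeSource : Bool × LineEdge C → Place C
  | (b, Sum.inl s) => placeOf C (before C b s.1)
  | (b, Sum.inr (Sum.inl j)) =>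
    placeOf C (station C b ⟨C.length + j, by unfold paddedLength; omega⟩)
  | (b, Sum.inr (Sum.inr (s, i))) =>
    match i with
    | 0 => placeOf C (before C b s.1)
    | 1 => Sum.inr (b, s, 0)
    | 2 => Sum.inr (b, s, 1)

/-- The second end of an edge. -/
def edgeTarget : Bool × LineEdge C → Place C
  | (b, Sum.inl s) => placeOf C (after C b s.1)
  | (b, Sum.inr (Sum.inl j)) =>
    placeOf C (station C b ⟨C.length + j + 1, by unfold paddedLength; omega⟩)
  | (b, Sum.inr (Sum.inr (s, i))) =>
    match i with
    | 0 => Sum.inr (b, s, 0)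
    | 1 => Sum.inr (b, s, 1)
    | 2 => placeOf C (after C b s.1)

/-- The edge to which a term belongs. -/
def termEdge : TermLabel C → Bool × LineEdge C
  | (b, Sum.inl s) => (b, Sum.inl s)
  | (b, Sum.inr (Sum.inl j)) => (b, Sum.inr (Sum.inl j))
  | (b, Sum.inr (Sum.inr (s, _, i))) => (b, Sum.inr (Sum.inr (s, i)))

lemma placeOf_termSource (i : TermLabel C) :
    placeOf C (termSource C i) = edgeSource C (termEdge C i) := by
  obtain ⟨b, s | j | ⟨s, k, i⟩⟩ := i
  · rfl
  · rfl
  · fin_cases i <;> rfl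

lemma placeOf_termTarget (i : TermLabel C) :
    placeOf C (termTarget C i) = edgeTarget C (termEdge C i) := by
  obtain ⟨b, s | j | ⟨s, k, i⟩⟩ := i
  · rfl
  · rfl
  · fin_cases i <;> rfl

lemma termSource_ne_termTarget (i : TermLabel C) : termSource C i ≠ termTarget C i := by
  obtain ⟨b, s | j | ⟨s, k, i⟩⟩ := i
  · exact station_ne C (by simp)
  · exact station_ne C (by simp)
  · fin_cases i
    · exact station_ne_rail C _ _ _ _ _ _
    · simp [termSource, termTarget, rail]
    · exact (station_ne_rail C _ _ _ _ _ _).symm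

/-! ### The work register along the line -/

section WorkRegister

variable (φ₀ : StateVec (Fin n))

/-- The state of the work register on the rail `(s, k, i)`. -/
def railState (s : SwitchStep C) (k i : Fin 2) : StateVec (Fin n) :=
  (if i = 1 ∧ k = 1 then onQubit (C[s.1].target s.2) pauliX else 1) *ᵥ
    (onQubit (C[s.1].control s.2) (ketbra k k) *ᵥ workState C φ₀ s.1)

/-- The state of the work register on a clock qubit. -/
def trainState : ClockQubit C → StateVec (Fin n)
  | Sum.inl t => workState C φ₀ t.1.2
  | Sum.inr (_, s, k, i) => railState C φ₀ s k i

lemma trainState_station (b : Bool) (t : Fin (paddedLength C + 1)) :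
    trainState C φ₀ (station C b t) = workState C φ₀ t := by
  rw [station_eq, trainState, stationOf_snd]

lemma trainState_before (b : Bool) (t : Fin C.length) :
    trainState C φ₀ (before C b t) = workState C φ₀ t :=
  trainState_station C φ₀ b _

lemma trainState_after (b : Bool) (t : Fin C.length) :
    trainState C φ₀ (after C b t) = workState C φ₀ (t + 1) :=
  trainState_station C φ₀ b _

lemma trainState_rail (b : Bool) (s : SwitchStep C) (k i : Fin 2) :
    trainState C φ₀ (rail C b s k i) = railState C φ₀ s k i := rfl

/-- A station place carries one clock qubit, a switch place two. Summing over all clock qubits of a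
place treats both cases uniformly, for orthogonality and for the action of the terms. -/
lemma legalState_eq_sum (p : Place C) :
    legalState C φ₀ p =
      ∑ c, if placeOf C c = p then withTrain C (trainState C φ₀ c) c else 0 := by
  rw [Fintype.sum_sum_type]
  obtain t | ⟨b, s, i⟩ := p
  · simp [placeOf, legalState, trainState]
  · simp only [placeOf, reduceCtorEq, if_false, Finset.sum_const_zero, zero_add,
      Fintype.sum_prod_type, Sum.inr.injEq, Prod.mk.injEq]
    rw [Finset.sum_eq_single b (by intro b' _ h; simp [h]) (by simp),
      Finset.sum_eq_single s (by intro s' _ h; simp [h]) (by simp)]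
    simp only [true_and, Finset.sum_ite_eq', Finset.mem_univ, if_true, Fin.sum_univ_two]
    fin_cases i <;> simp [legalState, trainState, railState, rail]

lemma legalState_rail (b : Bool) (s : SwitchStep C) (i : Fin 2) :
    legalState C φ₀ (Sum.inr (b, s, i)) =
      ∑ k, withTrain C (railState C φ₀ s k i) (rail C b s k i) := by
  rw [Fin.sum_univ_two]
  fin_cases i <;> simp [legalState, railState, rail]

lemma legalState_placeOf_station (b : Bool) (t : Fin (paddedLength C + 1)) :
    legalState C φ₀ (placeOf C (station C b t)) =
      withTrain C (workState C φ₀ t) (station C b t) := by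
  rw [station_eq, placeOf, legalState, stationOf_snd]

lemma sum_projected (s : SwitchStep C) :
    ∑ k, onQubit (C[s.1].control s.2) (ketbra k k) *ᵥ workState C φ₀ s.1 =
      workState C φ₀ s.1 := by
  rw [← Matrix.sum_mulVec, sum_onQubit_ketbra, Matrix.one_mulVec]

/-- The two branches recombine at the end of the switch: `P₀ φ + σˣ P₁ φ` is the CNOT applied to
`φ`. -/
lemma sum_railState (s : SwitchStep C) :
    ∑ k, railState C φ₀ s k 1 = workState C φ₀ (s.1 + 1) := by
  rw [workState_succ, Gate.op_of_cnot _ s.2, Matrix.add_mulVec, ← Matrix.mulVec_mulVec]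
  simp [railState]

/-- Control and target differ, so the flip commutes with the control projector and the branch stays
sharp along its track. -/
lemma projector_mulVec_railState (s : SwitchStep C) (k l i : Fin 2) :
    onQubit (C[s.1].control s.2) (ketbra k k) *ᵥ railState C φ₀ s l i =
      if k = l then railState C φ₀ s l i else 0 := by
  have hc := onQubit_commute (Gate.control_ne_target _ s.2) (ketbra k k) pauliX
  have hp : onQubit (C[s.1].control s.2) (ketbra k k) * onQubit (C[s.1].control s.2) (ketbra l l) =
      if k = l then onQubit (C[s.1].control s.2) (ketbra l l) else 0 := by
    split_ifs with h
    · rw [h, onQubit_mul, ketbra_mul]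
    · rw [onQubit_mul, ketbra_mul_of_ne _ _ h, onQubit_zero]
  have hV : Commute (onQubit (C[s.1].control s.2) (ketbra k k))
      (if i = 1 ∧ l = 1 then onQubit (C[s.1].target s.2) pauliX else 1) := by
    split_ifs
    · exact hc
    · exact Commute.one_right _
  rw [railState, Matrix.mulVec_mulVec, hV.eq, ← Matrix.mulVec_mulVec,
    Matrix.mulVec_mulVec (workState C φ₀ s.1), hp]
  split_ifs <;> simp

lemma projector_mulVec_workState_succ (s : SwitchStep C) (k : Fin 2) :
    onQubit (C[s.1].control s.2) (ketbra k k) *ᵥ workState C φ₀ (s.1 + 1) =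
      railState C φ₀ s k 1 := by
  rw [← sum_railState, Matrix.mulVec_sum,
    Finset.sum_congr rfl fun l _ => projector_mulVec_railState C φ₀ s k l 1, Finset.sum_ite_eq,
    if_pos (Finset.mem_univ _)]

lemma railState_zero (s : SwitchStep C) (k : Fin 2) :
    railState C φ₀ s k 0 = onQubit (C[s.1].control s.2) (ketbra k k) *ᵥ workState C φ₀ s.1 := by
  simp [railState]

lemma flip_mulVec_railState_zero (s : SwitchStep C) (k : Fin 2) :
    (if k = 1 then onQubit (C[s.1].target s.2) pauliX else 1) *ᵥ railState C φ₀ s k 0 =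
      railState C φ₀ s k 1 := by
  simp [railState]

lemma flip_mul_self (q : Fin n) (k : Fin 2) :
    (if k = 1 then onQubit q pauliX else 1) * (if k = 1 then onQubit q pauliX else 1) = 1 := by
  split_ifs
  · rw [onQubit_mul, pauliX_mul_self, onQubit_one]
  · rw [one_mul]

lemma flip_mulVec_railState_one (s : SwitchStep C) (k : Fin 2) :
    (if k = 1 then onQubit (C[s.1].target s.2) pauliX else 1) *ᵥ railState C φ₀ s k 1 =
      railState C φ₀ s k 0 := by
  rw [← flip_mulVec_railState_zero, Matrix.mulVec_mulVec, flip_mul_self, Matrix.one_mulVec]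

/-- The flip is unitary, so the branch norms are those of `P_k φ`, which add up because the
projectors resolve the identity. -/
lemma sum_star_railState_dotProduct (s : SwitchStep C) (i : Fin 2) :
    ∑ k, star (railState C φ₀ s k i) ⬝ᵥ railState C φ₀ s k i = star φ₀ ⬝ᵥ φ₀ := by
  have h0 : ∀ k, star (railState C φ₀ s k i) ⬝ᵥ railState C φ₀ s k i =
      star (workState C φ₀ s.1) ⬝ᵥ
        (onQubit (C[s.1].control s.2) (ketbra k k) *ᵥ workState C φ₀ s.1) := by
    intro k
    have hp := isStarProjection_onQubit (C[s.1].control s.2) k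
    rw [railState, star_mulVec_dotProduct, Matrix.star_mulVec, Matrix.dotProduct_mulVec,
      Matrix.vecMul_vecMul, ← Matrix.star_eq_conjTranspose, hp.isSelfAdjoint.star_eq,
      hp.isIdempotentElem.eq, ← Matrix.dotProduct_mulVec]
    split_ifs
    · rw [onQubit_conjTranspose, pauliX_conjTranspose, onQubit_mul, pauliX_mul_self, onQubit_one]
    · simp
  rw [Finset.sum_congr rfl fun k _ => h0 k, ← dotProduct_sum, sum_projected,
    star_workState_dotProduct]

/-- Different places share no clock qubit; at equal places the norms on the clock qubits of the
place sum to that of `φ₀`. -/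
lemma star_legalState_dotProduct (hφ : star φ₀ ⬝ᵥ φ₀ = 1) (p q : Place C) :
    star (legalState C φ₀ p) ⬝ᵥ legalState C φ₀ q = if p = q then 1 else 0 := by
  have h : star (legalState C φ₀ p) ⬝ᵥ legalState C φ₀ q =
      ∑ c, if placeOf C c = p ∧ placeOf C c = q then
        star (trainState C φ₀ c) ⬝ᵥ trainState C φ₀ c else 0 := by
    rw [legalState_eq_sum, legalState_eq_sum, star_sum, sum_dotProduct]
    refine Finset.sum_congr rfl fun c _ => ?_
    rw [dotProduct_sum, Finset.sum_eq_single c]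
    · by_cases hp : placeOf C c = p
      · by_cases hq : placeOf C c = q
        · rw [if_pos hp, if_pos hq, if_pos ⟨hp, hq⟩, star_withTrain_dotProduct, if_pos rfl]
        · rw [if_neg hq, dotProduct_zero, if_neg fun h => hq h.2]
      · rw [if_neg hp, star_zero, zero_dotProduct, if_neg fun h => hp h.1]
    · intro d _ hd
      by_cases hp : placeOf C c = p
      · by_cases hq : placeOf C d = q
        · rw [if_pos hp, if_pos hq, star_withTrain_dotProduct, if_neg hd.symm]
        · rw [if_neg hq, dotProduct_zero]
      · rw [if_neg hp, star_zero, zero_dotProduct]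
    · simp
  rw [h]
  split_ifs with hpq
  · subst hpq
    rw [Fintype.sum_sum_type]
    obtain t | ⟨b, s, i⟩ := p
    · simp [placeOf, trainState, star_workState_dotProduct, hφ]
    · simp only [placeOf, reduceCtorEq, if_false, Finset.sum_const_zero, zero_add,
        Fintype.sum_prod_type, Sum.inr.injEq, Prod.mk.injEq, and_self]
      rw [Finset.sum_eq_single b (by intro b' _ h; simp [h]) (by simp),
        Finset.sum_eq_single s (by intro s' _ h; simp [h]) (by simp)]
      simp only [true_and, Finset.sum_ite_eq', Finset.mem_univ, if_true, trainState]
      rw [sum_star_railState_dotProduct, hφ]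
  · refine Finset.sum_eq_zero fun c _ => if_neg ?_
    rintro ⟨h, h'⟩
    exact hpq (h.symm.trans h')

end WorkRegister

/-! ### The action of the terms -/

section Action

variable (φ₀ : StateVec (Fin n))

/-- The states of the work register before and after the term `i`, restricted to the branch of the
control qubit on which the term acts. -/
def termStates : TermLabel C → StateVec (Fin n) × StateVec (Fin n)
  | (_, Sum.inl s) => (workState C φ₀ s.1, workState C φ₀ (s.1 + 1))
  | (_, Sum.inr (Sum.inl j)) => (workState C φ₀ (C.length + j), workState C φ₀ (C.length + j + 1))
  | (_, Sum.inr (Sum.inr (s, k, i))) =>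
    match i with
    | 0 => (railState C φ₀ s k 0, railState C φ₀ s k 0)
    | 1 => (railState C φ₀ s k 0, railState C φ₀ s k 1)
    | 2 => (railState C φ₀ s k 1, railState C φ₀ s k 1)

/-- The image under the term `i` of the legal state which it leaves. -/
def departure (i : TermLabel C) : StateVec (Qubit C) :=
  (1 / 2 : ℂ) • (withTrain C (termStates C φ₀ i).1 (termSource C i) -
    withTrain C (termStates C φ₀ i).2 (termTarget C i))

/-- The common shape of all terms. The four hypotheses say that, within the branch selected by `R`,
the operators `W` and `W'` match the work states at the two ends; departures from `a` and from `b`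
then give opposite vectors. -/
lemma mul_transition_mulVec {Q V : Operator (Qubit C)} {R W W' : Operator (Fin n)}
    (hQ : Lifts C Q R) (hV : Lifts C V W) (hV' : Lifts C Vᴴ W') {a b : ClockQubit C} (hab : a ≠ b)
    {u w : StateVec (Fin n)} (h1 : R *ᵥ trainState C φ₀ a = u)
    (h2 : R *ᵥ (W *ᵥ trainState C φ₀ a) = w) (h3 : R *ᵥ trainState C φ₀ b = w)
    (h4 : R *ᵥ (W' *ᵥ trainState C φ₀ b) = u) (c : ClockQubit C) :
    (Q * transition C V a b) *ᵥ withTrain C (trainState C φ₀ c) c =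
      ((if c = a then 1 else 0) - (if c = b then 1 else 0) : ℂ) •
        (1 / 2 : ℂ) • (withTrain C u a - withTrain C w b) := by
  rw [← Matrix.mulVec_mulVec, transition_mulVec_withTrain C _ _ hV hV' hab, Matrix.mulVec_smul,
    Matrix.mulVec_add]
  by_cases hca : c = a
  · subst hca
    simp [hab, Matrix.mulVec_sub, hQ _ _, h1, h2]
  · by_cases hcb : c = b
    · subst hcb
      simp only [if_neg hca, Matrix.mulVec_zero, zero_add, if_true, Matrix.mulVec_sub, hQ _ _, h3,
        h4]
      module
    · simp [hca, hcb]

lemma term_mulVec_withTrain (i : TermLabel C) (c : ClockQubit C) :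
    term C i *ᵥ withTrain C (trainState C φ₀ c) c =
      ((if c = termSource C i then 1 else 0) - (if c = termTarget C i then 1 else 0) : ℂ) •
        departure C φ₀ i := by
  have hne := termSource_ne_termTarget C i
  have h1 := lifts_one C
  have h1' : Lifts C (1 : Operator (Qubit C))ᴴ 1 := by rw [Matrix.conjTranspose_one]; exact h1
  obtain ⟨b, s | j | ⟨s, k, i⟩⟩ := i
  · rw [term, singleTerm, ← one_mul (transition C _ _ _)]
    have hV' : Lifts C (onQubit (Sum.inl (C[s.1].qubit s.2)) (C[s.1].matrix s.2))ᴴ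
        (onQubit (C[s.1].qubit s.2) (C[s.1].matrix s.2)ᴴ) := by
      rw [onQubit_conjTranspose]; exact lifts_onQubit C _ _
    refine mul_transition_mulVec C φ₀ (a := before C b s.1) (b := after C b s.1)
      (u := workState C φ₀ s.1) (w := workState C φ₀ (s.1 + 1))
      h1 (lifts_onQubit C _ _) hV' hne ?_ ?_ ?_ ?_ c
    · rw [Matrix.one_mulVec, trainState_before]
    · rw [Matrix.one_mulVec, trainState_before, ← Gate.op_of_single, ← workState_succ]
    · rw [Matrix.one_mulVec, trainState_after]
    · rw [Matrix.one_mulVec, trainState_after, workState_succ, Gate.op_of_single _ s.2,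
        Matrix.mulVec_mulVec, onQubit_mul, Gate.matrix_star_mul, onQubit_one, Matrix.one_mulVec]
  · rw [term, idleTerm, ← one_mul (transition C _ _ _)]
    have h := workState_succ_of_le C φ₀ (Nat.le_add_right C.length j)
    have hs := trainState_station C φ₀ b ⟨C.length + j, by unfold paddedLength; omega⟩
    have ht := trainState_station C φ₀ b ⟨C.length + j + 1, by unfold paddedLength; omega⟩
    refine mul_transition_mulVec C φ₀ (u := workState C φ₀ (C.length + j))
      (w := workState C φ₀ (C.length + j + 1)) h1 h1 h1' hne ?_ ?_ ?_ ?_ c <;>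
      simp only [Matrix.one_mulVec]
    · exact hs
    · exact hs.trans h.symm
    · exact ht
    · exact ht.trans h
  · have hQ := lifts_onQubit C (C[s.1].control s.2) (ketbra k k)
    fin_cases i
    · refine mul_transition_mulVec C φ₀ (a := before C b s.1) (b := rail C b s k 0)
        (u := railState C φ₀ s k 0) (w := railState C φ₀ s k 0) hQ h1 h1' hne ?_ ?_ ?_ ?_ c
      · rw [trainState_before, railState_zero]
      · rw [Matrix.one_mulVec, trainState_before, railState_zero]
      · rw [trainState_rail, projector_mulVec_railState, if_pos rfl]
      · rw [Matrix.one_mulVec, trainState_rail, projector_mulVec_railState, if_pos rfl]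
    · change (transition C (if k = 1 then onQubit (Sum.inl (C[s.1].target s.2)) pauliX else 1)
        (rail C b s k 0) (rail C b s k 1)) *ᵥ _ = _
      rw [← one_mul (transition C _ _ _)]
      have hV : Lifts C (if k = 1 then onQubit (Sum.inl (C[s.1].target s.2)) pauliX else 1)
          (if k = 1 then onQubit (C[s.1].target s.2) pauliX else 1) := by
        split_ifs
        · exact lifts_onQubit C _ _
        · exact h1
      have hV' : Lifts C (if k = 1 then onQubit (Sum.inl (C[s.1].target s.2)) pauliX else 1)ᴴ
          (if k = 1 then onQubit (C[s.1].target s.2) pauliX else 1) := by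
        split_ifs
        · rw [onQubit_conjTranspose, pauliX_conjTranspose]; exact lifts_onQubit C _ _
        · exact h1'
      refine mul_transition_mulVec C φ₀ (a := rail C b s k 0) (b := rail C b s k 1)
        (u := railState C φ₀ s k 0) (w := railState C φ₀ s k 1) h1 hV hV' hne ?_ ?_ ?_ ?_ c <;>
        rw [Matrix.one_mulVec, trainState_rail]
      · rw [flip_mulVec_railState_zero]
      · rw [flip_mulVec_railState_one]
    · refine mul_transition_mulVec C φ₀ (a := rail C b s k 1) (b := after C b s.1)
        (u := railState C φ₀ s k 1) (w := railState C φ₀ s k 1) hQ h1 h1' hne ?_ ?_ ?_ ?_ c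
      · rw [trainState_rail, projector_mulVec_railState, if_pos rfl]
      · rw [Matrix.one_mulVec, trainState_rail, projector_mulVec_railState, if_pos rfl]
      · rw [trainState_after, projector_mulVec_workState_succ]
      · rw [Matrix.one_mulVec, trainState_after, projector_mulVec_workState_succ]

/-- The incidence numbers of places and edges. -/
def incidence (p : Place C) (e : Bool × LineEdge C) : ℂ :=
  (if p = edgeSource C e then 1 else 0) - (if p = edgeTarget C e then 1 else 0)

/-- Source and target of a term each occur in exactly one place, so only the legal states at the two
ends of its edge survive. -/
lemma term_mulVec_legalState (i : TermLabel C) (p : Place C) :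
    term C i *ᵥ legalState C φ₀ p = incidence C p (termEdge C i) • departure C φ₀ i := by
  have h : ∀ c, term C i *ᵥ (if placeOf C c = p then withTrain C (trainState C φ₀ c) c else 0) =
      ((if c = termSource C i then if placeOf C c = p then 1 else 0 else 0) -
        (if c = termTarget C i then if placeOf C c = p then 1 else 0 else 0) : ℂ) •
        departure C φ₀ i := by
    intro c
    by_cases hc : placeOf C c = p
    · simp [hc, term_mulVec_withTrain]
    · simp [hc]
  rw [legalState_eq_sum, Matrix.mulVec_sum, Finset.sum_congr rfl fun c _ => h c,
    ← Finset.sum_smul, Finset.sum_sub_distrib, Finset.sum_ite_eq', Finset.sum_ite_eq',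
    if_pos (Finset.mem_univ _), if_pos (Finset.mem_univ _), placeOf_termSource, placeOf_termTarget,
    incidence]
  simp only [eq_comm]

/-- Half the difference of the legal states at the ends of an edge. -/
def edgeDifference (e : Bool × LineEdge C) : StateVec (Qubit C) :=
  (1 / 2 : ℂ) • (legalState C φ₀ (edgeSource C e) - legalState C φ₀ (edgeTarget C e))

lemma departure_single (b : Bool) (s : SingleStep C) :
    departure C φ₀ (b, Sum.inl s) = edgeDifference C φ₀ (b, Sum.inl s) :=
  congrArg₂ (fun v w : StateVec (Qubit C) => (1 / 2 : ℂ) • (v - w))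
    (legalState_placeOf_station C φ₀ b _).symm (legalState_placeOf_station C φ₀ b _).symm

lemma departure_idle (b : Bool) (j : Fin (2 * computationTime C)) :
    departure C φ₀ (b, Sum.inr (Sum.inl j)) = edgeDifference C φ₀ (b, Sum.inr (Sum.inl j)) :=
  congrArg₂ (fun v w : StateVec (Qubit C) => (1 / 2 : ℂ) • (v - w))
    (legalState_placeOf_station C φ₀ b _).symm (legalState_placeOf_station C φ₀ b _).symm

/-- One track alone does not produce a difference of legal states. Adding the tracks does: the
control branches sum to the full state at a station, and the two rails form the legal state inside
the switch. -/
lemma sum_departure_switch (b : Bool) (s : SwitchStep C) (i : Fin 3) :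
    ∑ k, departure C φ₀ (b, Sum.inr (Sum.inr (s, k, i))) =
      edgeDifference C φ₀ (b, Sum.inr (Sum.inr (s, i))) := by
  have hb : ∑ k, withTrain C (railState C φ₀ s k 0) (before C b s.1) =
      legalState C φ₀ (placeOf C (before C b s.1)) := by
    rw [← withTrain_sum, before, legalState_placeOf_station]
    simp only [railState_zero, sum_projected]
  have ha : ∑ k, withTrain C (railState C φ₀ s k 1) (after C b s.1) =
      legalState C φ₀ (placeOf C (after C b s.1)) := by
    rw [← withTrain_sum, after, legalState_placeOf_station, sum_railState]
  have hr := fun i => (legalState_rail C φ₀ b s i).symm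
  have key : ∀ {f g : Fin 2 → StateVec (Qubit C)} {v w : StateVec (Qubit C)},
      ∑ k, f k = v → ∑ k, g k = w →
        ∑ k, (1 / 2 : ℂ) • (f k - g k) = (1 / 2 : ℂ) • (v - w) := by
    rintro f g _ _ rfl rfl
    rw [← Finset.smul_sum, Finset.sum_sub_distrib]
  fin_cases i
  · exact key hb (hr 0)
  · exact key (hr 0) (hr 1)
  · exact key (hr 1) ha

lemma sum_smul_departure (f : Bool × LineEdge C → ℂ) :
    ∑ i, f (termEdge C i) • departure C φ₀ i = ∑ e, f e • edgeDifference C φ₀ e := by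
  simp only [Fintype.sum_prod_type, Fintype.sum_sum_type, termEdge, departure_single,
    departure_idle, ← sum_departure_switch, Finset.smul_sum]
  refine Finset.sum_congr rfl fun b _ => ?_
  congr 2
  exact Finset.sum_congr rfl fun s _ => Finset.sum_comm

/-- Half the graph Laplacian, factored as incidence matrix times its transpose. -/
lemma hamiltonian_mulVec_legalState (p : Place C) :
    hamiltonian C *ᵥ legalState C φ₀ p = ∑ e, incidence C p e • edgeDifference C φ₀ e := by
  rw [hamiltonian, Matrix.sum_mulVec, ← sum_smul_departure]
  exact Finset.sum_congr rfl fun i _ => term_mulVec_legalState C φ₀ i p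

lemma term_mulVec_historyState (i : TermLabel C) : term C i *ᵥ historyState C φ₀ = 0 := by
  rw [historyState, Matrix.mulVec_smul, Matrix.mulVec_sum,
    Finset.sum_congr rfl fun p _ => term_mulVec_legalState C φ₀ i p, ← Finset.sum_smul]
  simp [incidence]

/-- A controlled term is a product of commuting projections, one on the control qubit and one on the
clock. -/
lemma isStarProjection_term (i : TermLabel C) : IsStarProjection (term C i) := by
  have hne := termSource_ne_termTarget C i
  have h1 : (1 : Operator (Qubit C))ᴴ * 1 = 1 := by simp
  have h2 : (1 : Operator (Qubit C)) * 1ᴴ = 1 := by simp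
  have hone := onWork_one C
  have act : ∀ (q : Fin n) (k : Fin 2) {a b : ClockQubit C}, a ≠ b →
      IsStarProjection (onQubit (Sum.inl q) (ketbra k k) * transition C 1 a b) := by
    intro q k a b hab
    refine (isStarProjection_onQubit _ k).mul (isStarProjection_transition hone h1 h2 hab) ?_
    have hW := onWork_onQubit C q (ketbra k k)
    rw [transition]
    simp only [Matrix.conjTranspose_one, one_mul]
    exact ((((hW.active C a).add_right (hW.active C b)).sub_right (hW.hop C a b)).sub_right
      (hW.hop C b a)).smul_right _
  obtain ⟨b, s | j | ⟨s, k, i⟩⟩ := i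
  · refine isStarProjection_transition (onWork_onQubit C _ _) ?_ ?_ hne <;>
      rw [onQubit_conjTranspose, onQubit_mul]
    · rw [Gate.matrix_star_mul, onQubit_one]
    · rw [Gate.matrix_mul_star, onQubit_one]
  · exact isStarProjection_transition hone h1 h2 hne
  · fin_cases i
    · exact act _ k hne
    · refine isStarProjection_transition ?_ ?_ ?_ hne
      · split_ifs
        · exact onWork_onQubit C _ _
        · exact hone
      all_goals
        split_ifs
        · rw [onQubit_conjTranspose, pauliX_conjTranspose, onQubit_mul, pauliX_mul_self,
            onQubit_one]
        · simp
    · exact act _ k hne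

lemma isLocal_term (i : TermLabel C) : IsLocal 3 (term C i) := by
  have two : ∀ {V : Operator (Qubit C)} (q : Fin n) (a b : ClockQubit C),
      ActsWithin {Sum.inl q, Sum.inr a, Sum.inr b} V →
      ActsWithin {Sum.inl q, Sum.inr a, Sum.inr b} Vᴴ →
      ActsWithin {Sum.inl q, Sum.inr a, Sum.inr b} (transition C V a b) :=
    fun q a b h h' => actsWithin_transition h h' (by simp) (by simp)
  have fin : ∀ {A : Operator (Qubit C)} (q : Fin n) (a b : ClockQubit C),
      ActsWithin {Sum.inl q, Sum.inr a, Sum.inr b} A → IsLocal 3 A :=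
    fun q a b h => h.isLocal.mono Finset.card_le_three
  have one' : ∀ S : Finset (Qubit C), ActsWithin S (1 : Operator (Qubit C))ᴴ := by
    intro S; rw [Matrix.conjTranspose_one]; exact actsWithin_one S
  obtain ⟨b, s | j | ⟨s, k, i⟩⟩ := i
  · refine fin _ _ _ (two (C[s.1].qubit s.2) _ _ (actsWithin_onQubit (by simp) _) ?_)
    rw [onQubit_conjTranspose]
    exact actsWithin_onQubit (by simp) _
  · have : ActsWithin {Sum.inr (termSource C (b, Sum.inr (Sum.inl j))),
        Sum.inr (termTarget C (b, Sum.inr (Sum.inl j)))} (term C (b, Sum.inr (Sum.inl j))) :=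
      actsWithin_transition (actsWithin_one _) (one' _) (by simp [termSource])
        (by simp [termTarget])
    exact this.isLocal.mono (Finset.card_le_two.trans (by norm_num))
  · fin_cases i
    · exact fin _ _ _ (.mul (actsWithin_onQubit (by simp) _)
        (two (C[s.1].control s.2) _ _ (actsWithin_one _) (one' _)))
    · refine fin _ _ _ (two (C[s.1].target s.2) _ _ ?_ ?_)
      · split_ifs
        · exact actsWithin_onQubit (by simp) _
        · exact actsWithin_one _
      · split_ifs
        · rw [onQubit_conjTranspose]; exact actsWithin_onQubit (by simp) _
        · exact one' _
    · exact fin _ _ _ (.mul (actsWithin_onQubit (by simp) _)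
        (two (C[s.1].control s.2) _ _ (actsWithin_one _) (one' _)))

end Action

end

noncomputable section

variable {n : ℕ} (C : Circuit n)

/-! ### Counting -/

lemma sum_ite_getElem_eq_countP {α : Type*} (l : List α) (p : α → Bool) :
    (∑ t : Fin l.length, if p l[t] = true then 1 else 0) = l.countP p := by
  induction l with
  | nil => simp
  | cons a l ih =>
    rw [List.countP_cons, ← ih]
    simp only [List.length_cons, Fin.sum_univ_succ, Fin.getElem_fin, Fin.val_zero, Fin.val_succ,
      List.getElem_cons_zero, List.getElem_cons_succ]
    exact add_comm _ _

lemma card_switchStep : Fintype.card (SwitchStep C) = numCnot C := by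
  rw [Fintype.card_subtype, Finset.card_filter, numCnot, ← sum_ite_getElem_eq_countP]

lemma card_singleStep : Fintype.card (SingleStep C) = numSingle C := by
  rw [Fintype.card_subtype, Finset.card_filter, numSingle, ← sum_ite_getElem_eq_countP]
  simp

lemma numSingle_add_numCnot : numSingle C + numCnot C = C.length := by
  rw [List.length_eq_countP_add_countP (fun g : Gate n => g.isCnot), numSingle, numCnot, add_comm]
  simp

lemma paddedLength_eq : paddedLength C = 3 * numSingle C + 7 * numCnot C := by
  rw [paddedLength, ← numSingle_add_numCnot, computationTime]; ring

lemma cycleLength_eq : cycleLength C = 6 * computationTime C := by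
  rw [cycleLength]; ring

variable {C} in
lemma computationTime_pos (hC : C ≠ []) : 0 < computationTime C := by
  have h := numSingle_add_numCnot C
  have := List.length_pos_iff.2 hC
  unfold computationTime; omega

lemma card_station (hC : C ≠ []) : Fintype.card (Station C) = 2 * paddedLength C := by
  have hP : 0 < paddedLength C := by
    have := List.length_pos_iff.2 hC; unfold paddedLength; omega
  -- Two distinct primed ends are removed from the two copies; this needs a line of positive length.
  have hne : ((true, 0) : Bool × Fin (paddedLength C + 1)) ≠ (true, Fin.last _) := by
    intro h
    have := congrArg (fun x => (x.2 : ℕ)) h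
    simp at this; omega
  have h : (Finset.univ.filter fun s : Bool × Fin (paddedLength C + 1) =>
      s.1 = true → s.2 ≠ 0 ∧ s.2 ≠ Fin.last _) =
      Finset.univ \ {(true, 0), (true, Fin.last _)} := by
    ext ⟨b, t⟩
    cases b <;> simp
  rw [Fintype.card_subtype, h, Finset.card_sdiff_of_subset (Finset.subset_univ _),
    Finset.card_pair hne, Finset.card_univ, Fintype.card_prod, Fintype.card_bool, Fintype.card_fin]
  omega

lemma card_qubit (hC : C ≠ []) :
    Fintype.card (Qubit C) = n + 6 * numSingle C + 22 * numCnot C := by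
  simp only [Fintype.card_sum, Fintype.card_prod, Fintype.card_fin, Fintype.card_bool,
    card_station C hC, card_switchStep, paddedLength_eq]
  ring

lemma card_termLabel :
    Fintype.card (TermLabel C) = 6 * numSingle C + 24 * numCnot C := by
  simp only [Fintype.card_sum, Fintype.card_prod, Fintype.card_fin, Fintype.card_bool,
    card_singleStep, card_switchStep]
  unfold computationTime
  ring

lemma card_place (hC : C ≠ []) : Fintype.card (Place C) = cycleLength C := by
  simp only [Fintype.card_sum, Fintype.card_prod, Fintype.card_fin, Fintype.card_bool,
    card_station C hC, card_switchStep, paddedLength_eq, cycleLength, computationTime]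
  ring

lemma card_edge : Fintype.card (Bool × LineEdge C) = cycleLength C := by
  simp only [Fintype.card_sum, Fintype.card_prod, Fintype.card_fin, Fintype.card_bool,
    card_singleStep, card_switchStep, cycleLength]
  unfold computationTime
  ring

/-! ### The clock steps along the line -/

lemma Gate.duration_of_single (g : Gate n) (h : g.isCnot = false) : g.duration = 1 := by
  cases g with
  | single q U => rfl
  | cnot c t d => simp [Gate.isCnot] at h

lemma Gate.duration_of_cnot (g : Gate n) (h : g.isCnot = true) : g.duration = 3 := by
  cases g with
  | single q U => simp [Gate.isCnot] at h
  | cnot c t d => rfl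

lemma lineTime_zero : lineTime C 0 = 0 := by simp [lineTime]

lemma lineTime_succ (t : Fin C.length) : lineTime C (t + 1) = lineTime C t + C[t].duration := by
  rw [lineTime, Finset.sum_range_succ]; simp [lineTime]

lemma lineTime_succ_of_le {t : ℕ} (ht : C.length ≤ t) :
    lineTime C (t + 1) = lineTime C t + 1 := by
  rw [lineTime, Finset.sum_range_succ, List.getElem?_eq_none ht]; rfl

lemma lineTime_mono : Monotone (lineTime C) := fun _ _ h =>
  Finset.sum_le_sum_of_subset (Finset.range_mono h)

lemma lineTime_cons (g : Gate n) (t : ℕ) :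
    lineTime (g :: C) (t + 1) = lineTime C t + g.duration := by
  rw [lineTime, Finset.sum_range_succ']; simp [lineTime]

lemma lineTime_length : lineTime C C.length = computationTime C := by
  induction C with
  | nil => rfl
  | cons g C ih =>
    rw [List.length_cons, lineTime_cons, ih]
    by_cases h : g.isCnot = true
    · rw [g.duration_of_cnot h]
      simp [computationTime, numSingle, numCnot, h]; ring
    · have h : g.isCnot = false := by simpa using h
      rw [g.duration_of_single h]
      simp [computationTime, numSingle, numCnot, h]; ring

lemma lineTime_length_add (j : ℕ) : lineTime C (C.length + j) = computationTime C + j := by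
  induction j with
  | zero => exact lineTime_length C
  | succ j ih => rw [← add_assoc, lineTime_succ_of_le C (by omega), ih, add_assoc]

lemma lineTime_paddedLength : lineTime C (paddedLength C) = 3 * computationTime C := by
  rw [paddedLength, lineTime_length_add]; ring

lemma lineTime_lt_succ (t : ℕ) : lineTime C t < lineTime C (t + 1) := by
  by_cases h : t < C.length
  · rw [lineTime_succ C ⟨t, h⟩]
    by_cases h' : C[t].isCnot = true
    · have := Gate.duration_of_cnot _ h'
      simp only [Fin.getElem_fin]; omega
    · have := Gate.duration_of_single C[t] (by simpa using h')
      simp only [Fin.getElem_fin]; omega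
  · rw [lineTime_succ_of_le C (not_lt.1 h)]; omega

lemma lineTime_strictMono : StrictMono (lineTime C) := strictMono_nat_of_lt_succ (lineTime_lt_succ C)

lemma lineTime_single (s : SingleStep C) : lineTime C (s.1 + 1) = lineTime C s.1 + 1 := by
  rw [lineTime_succ, Gate.duration_of_single _ s.2]

lemma lineTime_switch (s : SwitchStep C) : lineTime C (s.1 + 1) = lineTime C s.1 + 3 := by
  rw [lineTime_succ, Gate.duration_of_cnot _ s.2]

lemma lineTime_succ_le (t : Fin C.length) : lineTime C (t + 1) ≤ computationTime C := by
  rw [← lineTime_length]; exact lineTime_mono C t.2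

lemma lineTime_le (t : Fin (paddedLength C + 1)) : lineTime C t ≤ 3 * computationTime C := by
  rw [← lineTime_paddedLength]; exact lineTime_mono C (Nat.lt_succ_iff.1 t.2)

/-- The clock step of an edge. -/
def edgeTime : LineEdge C → ℕ
  | Sum.inl s => lineTime C s.1
  | Sum.inr (Sum.inl j) => lineTime C (C.length + j)
  | Sum.inr (Sum.inr (s, i)) => lineTime C s.1 + i

/-- The edges tile the line: the step `m` falls between two consecutive stations, and a gate of
duration three supplies one edge for each of its clock steps. -/
lemma exists_edgeTime_eq {m : ℕ} (hm : m < 3 * computationTime C) : ∃ l, edgeTime C l = m := by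
  have key : ∀ t ≤ paddedLength C, m < lineTime C t → ∃ l, edgeTime C l = m := by
    intro t
    induction t with
    | zero => intro _ h; simp [lineTime_zero] at h
    | succ t ih =>
      intro ht h
      by_cases h' : m < lineTime C t
      · exact ih (by omega) h'
      · by_cases hl : t < C.length
        · by_cases hc : C[t].isCnot = true
          · have := lineTime_switch C ⟨⟨t, hl⟩, hc⟩
            simp only at this
            refine ⟨Sum.inr (Sum.inr (⟨⟨t, hl⟩, hc⟩, ⟨m - lineTime C t, by omega⟩)), ?_⟩
            simp only [edgeTime]; omega
          · have hs : C[(⟨t, hl⟩ : Fin C.length)].isCnot = false := by simpa using hc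
            have := lineTime_single C ⟨⟨t, hl⟩, hs⟩
            simp only at this
            refine ⟨Sum.inl ⟨⟨t, hl⟩, hs⟩, ?_⟩
            simp only [edgeTime]; omega
        · have := lineTime_succ_of_le C (not_lt.1 hl)
          have hp : paddedLength C = C.length + 2 * computationTime C := rfl
          refine ⟨Sum.inr (Sum.inl ⟨t - C.length, by omega⟩), ?_⟩
          simp only [edgeTime]
          rw [Nat.add_sub_cancel' (not_lt.1 hl)]; omega
  exact key _ le_rfl (by rwa [lineTime_paddedLength])

/-! ### Positions on the cycle -/

/-- The position of a place, modulo the length of the cycle. -/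
def cyclicPosition (p : Place C) : ZMod (cycleLength C) := (cyclePosition C p : ZMod (cycleLength C))

/-- Clock steps of the two copies of the line as positions on the cycle. -/
def foldTime (b : Bool) (m : ℕ) : ZMod (cycleLength C) := if b then -m else m

lemma natCast_cycleLength_sub {m : ℕ} (hm : m ≤ cycleLength C) :
    ((cycleLength C - m : ℕ) : ZMod (cycleLength C)) = -m := by
  rw [Nat.cast_sub hm, ZMod.natCast_self, zero_sub]

lemma cyclicPosition_station (b : Bool) (t : Fin (paddedLength C + 1)) :
    cyclicPosition C (placeOf C (station C b t)) = foldTime C b (lineTime C t) := by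
  have hN : cycleLength C = 2 * (3 * computationTime C) := rfl
  have hle := lineTime_le C t
  rw [station_eq, placeOf, cyclicPosition, cyclePosition, stationOf_snd, foldTime]
  unfold stationOf
  cases b
  · split_ifs <;> simp_all
  · by_cases h : t = 0 ∨ t = Fin.last (paddedLength C)
    · rw [dif_pos h]
      simp only [Bool.false_eq_true, if_false, if_true]
      -- The identified ends are stored unprimed. They get the right primed position because `-0 =
      -- 0` and `3M = -3M` modulo `6M`.
      rcases h with rfl | rfl
      · simp [lineTime_zero]
      · rw [Fin.val_last, lineTime_paddedLength, ← natCast_cycleLength_sub C (by omega)]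
        congr 1; omega
    · rw [dif_neg h]
      simp only [if_true]
      exact natCast_cycleLength_sub C (by omega)

lemma cyclicPosition_rail (b : Bool) (s : SwitchStep C) (i : Fin 2) :
    cyclicPosition C (Sum.inr (b, s, i)) = foldTime C b (lineTime C s.1 + 1 + i) := by
  have hN : cycleLength C = 2 * (3 * computationTime C) := rfl
  have h1 := lineTime_switch C s
  have h2 := lineTime_succ_le C s.1
  cases b
  · simp [cyclicPosition, cyclePosition, foldTime]
  · simp only [cyclicPosition, cyclePosition, foldTime, if_true]
    exact natCast_cycleLength_sub C (by omega)

lemma cyclicPosition_edgeSource (b : Bool) (l : LineEdge C) :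
    cyclicPosition C (edgeSource C (b, l)) = foldTime C b (edgeTime C l) := by
  obtain s | j | ⟨s, i⟩ := l
  · exact cyclicPosition_station C b _
  · exact cyclicPosition_station C b _
  · fin_cases i
    · exact cyclicPosition_station C b _
    · exact cyclicPosition_rail C b s 0
    · exact cyclicPosition_rail C b s 1

lemma cyclicPosition_edgeTarget (b : Bool) (l : LineEdge C) :
    cyclicPosition C (edgeTarget C (b, l)) = foldTime C b (edgeTime C l + 1) := by
  obtain s | j | ⟨s, i⟩ := l
  · exact (cyclicPosition_station C b _).trans (congrArg _ (lineTime_single C s))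
  · exact (cyclicPosition_station C b _).trans
      (congrArg _ (lineTime_succ_of_le C (Nat.le_add_right _ _)))
  · fin_cases i
    · exact cyclicPosition_rail C b s 0
    · exact cyclicPosition_rail C b s 1
    · exact (cyclicPosition_station C b _).trans (congrArg _ (lineTime_switch C s))

/-- The position of the end of an edge that comes first along the cycle. -/
def edgePosition : Bool × LineEdge C → ZMod (cycleLength C)
  | (b, l) => foldTime C b (edgeTime C l + if b then 1 else 0)

lemma exists_edge (z : ZMod (cycleLength C)) (hC : C ≠ []) :
    (∃ l, foldTime C false (edgeTime C l) = z) ∨ ∃ l, foldTime C true (edgeTime C l + 1) = z := by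
  have hN : cycleLength C = 2 * (3 * computationTime C) := rfl
  have hM := computationTime_pos hC
  have : NeZero (cycleLength C) := ⟨by omega⟩
  have hz := ZMod.val_lt z
  by_cases h : z.val < 3 * computationTime C
  · obtain ⟨l, hl⟩ := exists_edgeTime_eq C h
    refine Or.inl ⟨l, ?_⟩
    simp [foldTime, hl]
  -- On the way back the cycle enters a primed edge at its later end, hence the shift by one.
  · obtain ⟨l, hl⟩ := exists_edgeTime_eq C
      (show cycleLength C - z.val - 1 < 3 * computationTime C by omega)
    refine Or.inr ⟨l, ?_⟩
    rw [foldTime, if_pos rfl, hl, Nat.sub_add_cancel (by omega),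
      natCast_cycleLength_sub C hz.le, neg_neg, ZMod.natCast_zmod_val]

lemma edgePosition_bijective (hC : C ≠ []) : Function.Bijective (edgePosition C) := by
  have hN : cycleLength C = 2 * (3 * computationTime C) := rfl
  have hM := computationTime_pos hC
  have : NeZero (cycleLength C) := ⟨by omega⟩
  refine (Fintype.bijective_iff_surjective_and_card _).2 ⟨fun z => ?_, ?_⟩
  · rcases exists_edge C z hC with ⟨l, hl⟩ | ⟨l, hl⟩
    · exact ⟨(false, l), hl⟩
    · exact ⟨(true, l), hl⟩
  · rw [card_edge, ZMod.card]

/-- Every residue is the position of an end of some edge, so the map is surjective; equal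
cardinalities do the rest. -/
lemma cyclicPosition_bijective (hC : C ≠ []) : Function.Bijective (cyclicPosition C) := by
  have hN : cycleLength C = 2 * (3 * computationTime C) := rfl
  have hM := computationTime_pos hC
  have : NeZero (cycleLength C) := ⟨by omega⟩
  refine (Fintype.bijective_iff_surjective_and_card _).2 ⟨fun z => ?_, ?_⟩
  · rcases exists_edge C z hC with ⟨l, hl⟩ | ⟨l, hl⟩
    · exact ⟨_, (cyclicPosition_edgeSource C false l).trans hl⟩
    · exact ⟨_, (cyclicPosition_edgeTarget C true l).trans hl⟩
  · rw [card_place C hC, ZMod.card]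

lemma cyclePosition_lt (hC : C ≠ []) (p : Place C) : cyclePosition C p < cycleLength C := by
  have hN : cycleLength C = 2 * (3 * computationTime C) := rfl
  have hM := computationTime_pos hC
  obtain ⟨⟨b, t⟩, ht⟩ | ⟨b, s, i⟩ := p
  · have hle := lineTime_le C t
    cases b
    · simp only [cyclePosition, Bool.false_eq_true, if_false]; omega
    -- A primed station at `0` would get position `N`; it is excluded because `c_{0'}` is identified
    -- with `c_0`.
    · have : t ≠ 0 := (ht rfl).1
      have h0 : 0 < (t : ℕ) := Fin.pos_iff_ne_zero.2 this
      have := lineTime_strictMono C h0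
      simp only [cyclePosition, if_true]; omega
  · have h1 := lineTime_switch C s
    have h2 := lineTime_succ_le C s.1
    cases b
    · simp only [cyclePosition, Bool.false_eq_true, if_false]; omega
    · simp only [cyclePosition, if_true]; omega

/-- The places, numbered along the cycle. -/
def placeEquiv (hC : C ≠ []) : Place C ≃ ZMod (cycleLength C) :=
  Equiv.ofBijective _ (cyclicPosition_bijective C hC)

/-- The legal states, numbered along the cycle. -/
def cycleState (hC : C ≠ []) (φ₀ : StateVec (Fin n)) (z : ZMod (cycleLength C)) :
    StateVec (Qubit C) :=
  legalState C φ₀ ((placeEquiv C hC).symm z)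

lemma legalState_eq_cycleState (hC : C ≠ []) (φ₀ : StateVec (Fin n)) (p : Place C) :
    legalState C φ₀ p = cycleState C hC φ₀ (cyclicPosition C p) := by
  rw [cycleState, show cyclicPosition C p = placeEquiv C hC p from rfl, Equiv.symm_apply_apply]

/-- Reindexed by position, exactly the edges at `z` and `z - 1` touch `z`, which gives the discrete
second difference. -/
lemma hamiltonian_mulVec_cycleState (hC : C ≠ []) (φ₀ : StateVec (Fin n))
    (z : ZMod (cycleLength C)) :
    hamiltonian C *ᵥ cycleState C hC φ₀ z = cycleState C hC φ₀ z -
      (1 / 2 : ℂ) • (cycleState C hC φ₀ (z + 1) + cycleState C hC φ₀ (z - 1)) := by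
  have : NeZero (cycleLength C) := ⟨by have := computationTime_pos hC; unfold cycleLength; omega⟩
  obtain ⟨p, rfl⟩ := (cyclicPosition_bijective C hC).2 z
  let g : ZMod (cycleLength C) → StateVec (Qubit C) := fun w =>
    ((if cyclicPosition C p = w then 1 else 0) -
      (if cyclicPosition C p - 1 = w then 1 else 0) : ℂ) • (1 / 2 : ℂ) •
        (cycleState C hC φ₀ w - cycleState C hC φ₀ (w + 1))
  -- Primed edges run against the cycle. This changes the sign of both the incidence number and the
  -- difference, so their product is independent of the orientation.
  have key : ∀ e, incidence C p e • edgeDifference C φ₀ e = g (edgePosition C e) := by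
    rintro ⟨b, l⟩
    have hinj := (cyclicPosition_bijective C hC).1
    simp only [g, incidence, edgeDifference, ← hinj.eq_iff, legalState_eq_cycleState C hC,
      cyclicPosition_edgeSource, cyclicPosition_edgeTarget, edgePosition, sub_eq_iff_eq_add]
    cases b
    · simp [foldTime]
    · simp only [foldTime, if_true, Nat.cast_add, Nat.cast_one, neg_add, neg_add_cancel_right]
      module
  rw [← legalState_eq_cycleState, hamiltonian_mulVec_legalState,
    Fintype.sum_bijective _ (edgePosition_bijective C hC) _ g key]
  simp only [g, sub_smul, Finset.sum_sub_distrib, ite_smul, one_smul, zero_smul, Finset.sum_ite_eq,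
    Finset.mem_univ, if_true, sub_add_cancel, legalState_eq_cycleState C hC]
  module

lemma cycleGraph_adj_iff {N : ℕ} (hN : 2 ≤ N) (u v : Fin N) :
    (SimpleGraph.cycleGraph N).Adj u v ↔
      ((u : ℕ) : ZMod N) = (v : ℕ) + 1 ∨ ((u : ℕ) : ZMod N) = (v : ℕ) - 1 := by
  have : NeZero N := ⟨by omega⟩
  have key : ∀ u v : Fin N, (u - v).val = 1 ↔ ((u : ℕ) : ZMod N) = (v : ℕ) + 1 := by
    intro u v
    have h : (((u - v : Fin N) : ℕ) : ZMod N) = (u : ℕ) - (v : ℕ) := by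
      rw [Fin.sub_def, ZMod.natCast_mod, Nat.cast_add, Nat.cast_sub v.2.le, ZMod.natCast_self]
      ring
    rw [← sub_eq_iff_eq_add', ← h, show (1 : ZMod N) = ((1 : ℕ) : ZMod N) by simp,
      ZMod.natCast_eq_natCast_iff', Nat.mod_eq_of_lt (u - v).2, Nat.mod_eq_of_lt (by omega)]
  rw [SimpleGraph.cycleGraph_adj', key, key, eq_sub_iff_add_eq, eq_comm (a := ((v : ℕ) : ZMod N))]

lemma exists_equiv_adjMatrix (hC : C ≠ []) (φ₀ : StateVec (Fin n)) :
    ∃ e : Place C ≃ Fin (cycleLength C), (∀ p, (e p : ℕ) = cyclePosition C p) ∧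
      ∀ q, hamiltonian C *ᵥ legalState C φ₀ q =
        ∑ p, (1 - (1 / 2 : ℂ) • (SimpleGraph.cycleGraph (cycleLength C)).adjMatrix ℂ :
          Matrix (Fin (cycleLength C)) (Fin (cycleLength C)) ℂ) (e p) (e q) •
            legalState C φ₀ p := by
  have hN : cycleLength C = 2 * (3 * computationTime C) := rfl
  have hM := computationTime_pos hC
  have : NeZero (cycleLength C) := ⟨by omega⟩
  have hb : Function.Bijective fun p => (⟨cyclePosition C p, cyclePosition_lt C hC p⟩ :
      Fin (cycleLength C)) := by
    refine (Fintype.bijective_iff_injective_and_card _).2 ⟨fun p q h => ?_, ?_⟩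
    · exact (cyclicPosition_bijective C hC).1 (congrArg (fun u : Fin (cycleLength C) =>
        ((u : ℕ) : ZMod (cycleLength C))) h)
    · rw [card_place C hC, Fintype.card_fin]
  refine ⟨Equiv.ofBijective _ hb, fun p => rfl, fun q => ?_⟩
  let g : ZMod (cycleLength C) → StateVec (Qubit C) := fun w =>
    ((if w = cyclicPosition C q then 1 else 0) - (1 / 2 : ℂ) *
      ((if w = cyclicPosition C q + 1 then 1 else 0) +
        if w = cyclicPosition C q - 1 then 1 else 0)) • cycleState C hC φ₀ w
  have hsum : ∀ p, (1 - (1 / 2 : ℂ) • (SimpleGraph.cycleGraph (cycleLength C)).adjMatrix ℂ :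
      Matrix (Fin (cycleLength C)) (Fin (cycleLength C)) ℂ) (Equiv.ofBijective _ hb p)
        (Equiv.ofBijective _ hb q) • legalState C φ₀ p =
      g (cyclicPosition C p) := by
    intro p
    have h1 : (Equiv.ofBijective _ hb p = Equiv.ofBijective _ hb q) ↔
        cyclicPosition C p = cyclicPosition C q := by
      rw [EmbeddingLike.apply_eq_iff_eq, (cyclicPosition_bijective C hC).1.eq_iff]
    have h2 := cycleGraph_adj_iff (by omega) (Equiv.ofBijective _ hb p) (Equiv.ofBijective _ hb q)
    change _ ↔ cyclicPosition C p = cyclicPosition C q + 1 ∨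
      cyclicPosition C p = cyclicPosition C q - 1 at h2
    -- The adjacency matrix has entries `0` and `1`, so the two neighbours must be distinct; this
    -- uses `N > 2`.
    have h3 : cyclicPosition C q + 1 ≠ cyclicPosition C q - 1 := by
      intro h
      have h : ((2 : ℕ) : ZMod (cycleLength C)) = 0 := by
        push_cast
        linear_combination h
      rw [ZMod.natCast_eq_zero_iff] at h
      exact absurd (Nat.le_of_dvd (by norm_num) h) (by omega)
    change _ = _ • cycleState C hC φ₀ (cyclicPosition C p)
    rw [← legalState_eq_cycleState, Matrix.sub_apply, Matrix.smul_apply, Matrix.one_apply,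
      SimpleGraph.adjMatrix_apply]
    simp only [h1, h2, smul_eq_mul]
    congr 3
    by_cases ha : cyclicPosition C p = cyclicPosition C q + 1
    · simp [ha, h3]
    · simp [ha]
  rw [Fintype.sum_bijective _ (cyclicPosition_bijective C hC) _ g hsum,
    legalState_eq_cycleState C hC, hamiltonian_mulVec_cycleState]
  simp only [g, sub_smul, mul_smul, add_smul, smul_add, Finset.sum_sub_distrib, Finset.sum_add_distrib,
    ite_smul, one_smul, zero_smul, smul_ite, smul_zero, Finset.sum_ite_eq', Finset.mem_univ, if_true]

end

noncomputable section

/-! ### Exponentials of matrices on eigenvectors -/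

section Exponential

attribute [local instance] Matrix.linftyOpNormedRing Matrix.linftyOpNormedAlgebra

/-- Applying the continuous map `B ↦ B v` to the exponential series gives the scalar exponential
series times `v`. The norm on matrices only serves the convergence. -/
lemma exp_mulVec_of_eigenvector {m : Type} [Fintype m] [DecidableEq m] {A : Matrix m m ℂ}
    {v : m → ℂ} {μ : ℂ} (h : A *ᵥ v = μ • v) (c : ℂ) :
    NormedSpace.exp (c • A) *ᵥ v = Complex.exp (c * μ) • v := by
  have hpow : ∀ k : ℕ, (c • A) ^ k *ᵥ v = (c * μ) ^ k • v := by
    intro k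
    induction k with
    | zero => simp
    | succ k ih =>
      rw [pow_succ, ← Matrix.mulVec_mulVec, Matrix.smul_mulVec, h, smul_smul, Matrix.mulVec_smul,
        ih, smul_smul, pow_succ, mul_comm]
  let f : Matrix m m ℂ →+ (m → ℂ) :=
    { toFun := fun B => B *ᵥ v, map_zero' := Matrix.zero_mulVec v,
      map_add' := fun B D => Matrix.add_mulVec B D v }
  have hf : Continuous f := Continuous.matrix_mulVec continuous_id continuous_const
  have h1 := (NormedSpace.exp_series_hasSum_exp' (𝕂 := ℂ) (c • A)).map f hf
  have h2 := (NormedSpace.exp_series_hasSum_exp' (𝕂 := ℂ) (c * μ)).smul_const v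
  refine h1.unique ?_
  rw [Complex.exp_eq_exp_ℂ]
  convert h2 using 2 with k
  change ((k.factorial : ℂ)⁻¹ • (c • A) ^ k) *ᵥ v = _
  rw [Matrix.smul_mulVec, hpow, smul_eq_mul, mul_smul]

end Exponential

/-! ### Plane waves on the cycle -/

section Waves

variable {N : ℕ} [NeZero N]

/-- The standard character of the cyclic group. -/
local notation "χ" => (ZMod.stdAddChar : AddChar (ZMod N) ℂ)

/-- The energy of the plane wave with momentum `k`. -/
def energy (k : ZMod N) : ℝ := 1 - (ZMod.stdAddChar k).re

lemma sum_stdAddChar_mul (z : ZMod N) : ∑ k : ZMod N, χ (k * z) = if z = 0 then (N : ℂ) else 0 := by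
  rw [AddChar.sum_mulShift z (ZMod.isPrimitive_stdAddChar N), ZMod.card]
  split_ifs <;> simp

lemma norm_stdAddChar (k : ZMod N) : ‖χ k‖ = 1 := AddChar.norm_apply _ _

lemma ofReal_energy (k : ZMod N) : (energy k : ℂ) = 1 - (χ k + χ (-k)) / 2 := by
  rw [AddChar.map_neg_eq_conj, Complex.add_conj, energy]
  push_cast
  ring

/-- The amplitude at time `τ` of the site `z` for a walk that starts at the site `0`. -/
def amplitude (τ : ℝ) (z : ZMod N) : ℂ :=
  (N : ℂ)⁻¹ * ∑ k, Complex.exp (-(Complex.I * τ) * energy k) * χ (k * z)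

variable {m : Type} [Fintype m] {A : Matrix m m ℂ} {g : ZMod N → m → ℂ}

/-- Shifting the summation index by `±1` multiplies a plane wave by `χ (∓k)`. Linear independence of
the `g z` plays no role. -/
lemma mulVec_planeWave (hA : ∀ z, A *ᵥ g z = g z - (1 / 2 : ℂ) • (g (z + 1) + g (z - 1)))
    (k : ZMod N) : A *ᵥ ∑ z, χ (k * z) • g z = (energy k : ℂ) • ∑ z, χ (k * z) • g z := by
  have h1 : ∑ z, χ (k * z) • g (z + 1) = χ (-k) • ∑ z, χ (k * z) • g z := by
    rw [Finset.smul_sum, 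
      ← Equiv.sum_comp (Equiv.addRight (1 : ZMod N)) fun z => χ (-k) • χ (k * z) • g z]
    refine Finset.sum_congr rfl fun z _ => ?_
    rw [Equiv.coe_addRight, smul_smul, ← AddChar.map_add_eq_mul]
    congr 2; ring
  have h2 : ∑ z, χ (k * z) • g (z - 1) = χ k • ∑ z, χ (k * z) • g z := by
    rw [Finset.smul_sum, 
      ← Equiv.sum_comp (Equiv.subRight (1 : ZMod N)) fun z => χ k • χ (k * z) • g z]
    refine Finset.sum_congr rfl fun z _ => ?_
    rw [Equiv.subRight_apply, smul_smul, ← AddChar.map_add_eq_mul]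
    congr 2; ring
  have h3 : A *ᵥ ∑ z, χ (k * z) • g z = ∑ z, χ (k * z) • g z -
      (1 / 2 : ℂ) • (∑ z, χ (k * z) • g (z + 1) + ∑ z, χ (k * z) • g (z - 1)) := by
    rw [Matrix.mulVec_sum, ← Finset.sum_add_distrib, Finset.smul_sum, ← Finset.sum_sub_distrib]
    refine Finset.sum_congr rfl fun z _ => ?_
    rw [Matrix.mulVec_smul, hA]
    module
  rw [h3, h1, h2, ofReal_energy]
  module

/-- Fourier inversion writes `g 0` as the mean of the plane waves, each of which only acquires a
phase. -/
lemma exp_mulVec_start [DecidableEq m]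
    (hA : ∀ z, A *ᵥ g z = g z - (1 / 2 : ℂ) • (g (z + 1) + g (z - 1))) (τ : ℝ) :
    NormedSpace.exp ((-(Complex.I * τ)) • A) *ᵥ g 0 = ∑ z, amplitude τ z • g z := by
  have hN : (N : ℂ) ≠ 0 := Nat.cast_ne_zero.2 (NeZero.ne N)
  have h0 : g 0 = (N : ℂ)⁻¹ • ∑ k, ∑ z, χ (k * z) • g z := by
    rw [Finset.sum_comm]
    simp only [← Finset.sum_smul, sum_stdAddChar_mul, ite_smul, zero_smul, Finset.sum_ite_eq',
      Finset.mem_univ, if_true]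
    rw [smul_smul, inv_mul_cancel₀ hN, one_smul]
  rw [h0, Matrix.mulVec_smul, Matrix.mulVec_sum,
    Finset.sum_congr rfl fun k _ => exp_mulVec_of_eigenvector (mulVec_planeWave hA k) _]
  simp only [amplitude, mul_smul, Finset.sum_smul, ← Finset.smul_sum]
  simp only [Finset.smul_sum (N := m → ℂ)]
  rw [Finset.sum_comm]

lemma continuous_amplitude (z : ZMod N) : Continuous fun τ : ℝ => amplitude τ z := by
  unfold amplitude
  fun_prop

/-! ### Time averages -/

/-- The distance between `1` and a value of the standard character. -/
def chord (d : ZMod N) : ℝ := ‖χ d - 1‖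

lemma chord_nonneg (d : ZMod N) : 0 ≤ chord d := norm_nonneg _

lemma chord_neg (d : ZMod N) : chord (-d) = chord d := by
  rw [chord, AddChar.map_neg_eq_conj, chord, ← Complex.norm_conj (χ d - 1), map_sub, map_one]

lemma stdAddChar_eq_one_iff (d : ZMod N) : χ d = 1 ↔ d = 0 := by
  rw [← AddChar.map_zero_eq_one χ, ZMod.injective_stdAddChar.eq_iff]

lemma chord_eq_zero_iff (d : ZMod N) : chord d = 0 ↔ d = 0 := by
  rw [chord, norm_eq_zero, sub_eq_zero, stdAddChar_eq_one_iff]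

/-- The product formula for a difference of cosines, in terms of characters. It shows that the only
degeneracies are `k = ±l`, and how fast the gap closes near them. -/
lemma abs_energy_sub (k l : ZMod N) : |energy k - energy l| = chord (k - l) * chord (k + l) / 2 := by
  have h : ((energy k - energy l : ℝ) : ℂ) = χ l * (χ (k - l) - 1) * (χ (-(k + l)) - 1) / 2 := by
    push_cast
    rw [ofReal_energy, ofReal_energy]
    have h1 : χ l * χ (k - l) = χ k := by rw [← AddChar.map_add_eq_mul]; congr 1; ring
    have h2 : χ k * χ (-(k + l)) = χ (-l) := by rw [← AddChar.map_add_eq_mul]; congr 1; ring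
    have h3 : χ l * χ (-(k + l)) = χ (-k) := by rw [← AddChar.map_add_eq_mul]; congr 1; ring
    linear_combination (1 / 2) * (χ (-(k + l)) - 1) * h1.symm + (1 / 2) * h2.symm - (1 / 2) * h3.symm
  rw [← Real.norm_eq_abs, ← Complex.norm_real, h, norm_div, norm_mul, norm_mul, norm_stdAddChar,
    ← chord_neg (k + l), chord, chord]
  simp

/-- The time average of `exp (-i μ τ)` over `[0, T]`. -/
def phaseAverage (T μ : ℝ) : ℂ := (T : ℂ)⁻¹ * ∫ τ in (0 : ℝ)..T, Complex.exp (-(Complex.I * μ) * τ)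

lemma phaseAverage_zero {T : ℝ} (hT : 0 < T) : phaseAverage T 0 = 1 := by
  have : (T : ℂ) ≠ 0 := by exact_mod_cast hT.ne'
  simp [phaseAverage, this]

lemma norm_phaseAverage_le {T : ℝ} (hT : 0 < T) {μ : ℝ} (hμ : μ ≠ 0) :
    ‖phaseAverage T μ‖ ≤ 2 / (T * |μ|) := by
  have hc : -(Complex.I * μ) ≠ 0 := by simp [hμ]
  have h1 : ∀ x : ℝ, ‖Complex.exp (-(Complex.I * μ) * x)‖ = 1 := by
    intro x; rw [Complex.norm_exp]; simp
  rw [phaseAverage, integral_exp_mul_complex hc, norm_mul, norm_div, norm_inv, norm_neg, norm_mul,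
    Complex.norm_I, one_mul, Complex.norm_real, Complex.norm_real, Real.norm_eq_abs,
    Real.norm_eq_abs, abs_of_pos hT]
  have h2 := norm_sub_le (Complex.exp (-(Complex.I * μ) * T))
    (Complex.exp (-(Complex.I * μ) * (0 : ℝ)))
  rw [h1, h1] at h2
  have hμ' := abs_pos.2 hμ
  rw [inv_mul_eq_div, div_div, div_le_div_iff₀ (by positivity) (by positivity), mul_comm T |μ|]
  gcongr
  linarith

/-- The probability to find the walk that starts at the site `0` in the region `S`. -/
def walkProbability (S : Finset (ZMod N)) (τ : ℝ) : ℝ := ∑ z ∈ S, ‖amplitude τ z‖ ^ 2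

lemma continuous_walkProbability (S : Finset (ZMod N)) : Continuous (walkProbability S) := by
  unfold walkProbability
  have := fun z : ZMod N => continuous_amplitude z
  fun_prop

/-- Expanding the squared modulus of the Fourier sum separates the time, which enters only through
energy differences, from the region, which enters only through a character sum at `k - l`. -/
lemma ofReal_walkProbability (S : Finset (ZMod N)) (τ : ℝ) :
    (walkProbability S τ : ℂ) = ((N : ℂ) ^ 2)⁻¹ * ∑ k : ZMod N, ∑ l : ZMod N,
      Complex.exp (-(Complex.I * (energy k - energy l : ℝ)) * τ) * ∑ z ∈ S, χ ((k - l) * z) := by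
  rw [walkProbability, Complex.ofReal_sum]
  have h : ∀ z : ZMod N, ((‖amplitude τ z‖ ^ 2 : ℝ) : ℂ) = ((N : ℂ) ^ 2)⁻¹ * ∑ k : ZMod N,
      ∑ l : ZMod N, Complex.exp (-(Complex.I * (energy k - energy l : ℝ)) * τ) *
        χ ((k - l) * z) := by
    intro z
    have hconj : (starRingEnd ℂ) (amplitude τ z) =
        (N : ℂ)⁻¹ * ∑ l, Complex.exp (Complex.I * τ * energy l) * χ (-(l * z)) := by
      simp only [amplitude, map_mul, map_inv₀, map_natCast, map_sum, ← Complex.exp_conj, map_neg,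
        Complex.conj_I, Complex.conj_ofReal, AddChar.map_neg_eq_conj, neg_mul, neg_neg]
    rw [Complex.ofReal_pow, ← Complex.mul_conj', hconj, amplitude, mul_mul_mul_comm, Finset.sum_mul_sum,
      sq, mul_inv]
    congr 1
    refine Finset.sum_congr rfl fun k _ => Finset.sum_congr rfl fun l _ => ?_
    rw [mul_mul_mul_comm, ← Complex.exp_add, ← AddChar.map_add_eq_mul]
    congr 2
    · push_cast; ring
    · ring
  rw [Finset.sum_congr rfl fun z _ => h z, ← Finset.mul_sum, Finset.sum_comm]
  congr 1
  refine Finset.sum_congr rfl fun k _ => ?_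
  rw [Finset.sum_comm]
  simp only [Finset.mul_sum]

lemma average_walkProbability (S : Finset (ZMod N)) (T : ℝ) :
    ((1 / T * ∫ τ in (0 : ℝ)..T, walkProbability S τ : ℝ) : ℂ) =
      ((N : ℂ) ^ 2)⁻¹ * ∑ k : ZMod N, ∑ l : ZMod N,
        phaseAverage T (energy k - energy l) * ∑ z ∈ S, χ ((k - l) * z) := by
  rw [Complex.ofReal_mul, ← intervalIntegral.integral_ofReal]
  simp only [ofReal_walkProbability]
  rw [intervalIntegral.integral_const_mul, intervalIntegral.integral_finsetSum]
  · have : ∀ k : ZMod N, ∫ τ in (0 : ℝ)..T, ∑ l : ZMod N,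
        Complex.exp (-(Complex.I * (energy k - energy l : ℝ)) * τ) * ∑ z ∈ S, χ ((k - l) * z) =
        ∑ l : ZMod N, (∫ τ in (0 : ℝ)..T,
          Complex.exp (-(Complex.I * (energy k - energy l : ℝ)) * τ)) *
            ∑ z ∈ S, χ ((k - l) * z) := by
      intro k
      rw [intervalIntegral.integral_finsetSum]
      · simp only [intervalIntegral.integral_mul_const]
      · intro l _
        exact Continuous.intervalIntegrable (by fun_prop) _ _
    rw [Finset.sum_congr rfl fun k _ => this k, mul_left_comm]
    congr 1
    simp only [phaseAverage, Finset.mul_sum, mul_assoc, one_div, Complex.ofReal_inv]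
  · intro k _
    exact Continuous.intervalIntegrable (by fun_prop) _ _

/-- For degenerate pairs the phase average is `1` and the left side vanishes exactly, so the
convention `0⁻¹ = 0` on the right is harmless. Otherwise the bounds `2/(T·gap)` and `2 / chord
(k-l)` multiply to the claim, with the factor `8` coming from the half in the gap. -/
lemma norm_average_sub_le (S : Finset (ZMod N)) {T : ℝ} (hT : 0 < T)
    (hS : ∀ d : ZMod N, d ≠ 0 → ‖∑ z ∈ S, χ (d * z)‖ ≤ 2 / chord d) (k l : ZMod N) :
    ‖phaseAverage T (energy k - energy l) * ∑ z ∈ S, χ ((k - l) * z) -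
      if k = l ∨ k = -l then ∑ z ∈ S, χ ((k - l) * z) else 0‖ ≤
      8 / T * ((chord (k - l))⁻¹ ^ 2 * (chord (k + l))⁻¹) := by
  have hpos : 0 ≤ 8 / T * ((chord (k - l))⁻¹ ^ 2 * (chord (k + l))⁻¹) := by
    have := chord_nonneg (k - l)
    have := chord_nonneg (k + l)
    positivity
  have habs := abs_energy_sub k l
  by_cases h : k = l ∨ k = -l
  · have h0 : energy k - energy l = 0 := by
      rw [← abs_eq_zero, habs]
      rcases h with rfl | rfl
      · rw [sub_self, (chord_eq_zero_iff 0).2 rfl]; simp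
      · rw [neg_add_cancel, (chord_eq_zero_iff 0).2 rfl]; simp
    rw [if_pos h, h0, phaseAverage_zero hT, one_mul, sub_self, norm_zero]
    exact hpos
  · rw [not_or] at h
    have h1 : k - l ≠ 0 := sub_ne_zero.2 h.1
    have h2 : k + l ≠ 0 := fun e => h.2 (eq_neg_of_add_eq_zero_left e)
    have c1 : 0 < chord (k - l) := (chord_nonneg _).lt_of_ne' fun e => h1 ((chord_eq_zero_iff _).1 e)
    have c2 : 0 < chord (k + l) := (chord_nonneg _).lt_of_ne' fun e => h2 ((chord_eq_zero_iff _).1 e)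
    have hne : energy k - energy l ≠ 0 := by
      rw [← abs_pos, habs]; positivity
    rw [if_neg (not_or.2 h), sub_zero, norm_mul]
    refine (mul_le_mul (norm_phaseAverage_le hT hne) (hS _ h1) (norm_nonneg _)
      (by positivity)).trans (le_of_eq ?_)
    rw [habs]
    field_simp
    norm_num

/-- Inclusion and exclusion: the pairs `k = l` give `N |S|`; the pairs `k = -l` give `∑ χ (2kz)`,
which by orthogonality counts the `z` in `S` with `2z = 0`; the pairs in both families, those with
`2k = 0`, are subtracted once. -/
lemma sum_stationary (S : Finset (ZMod N)) :
    ∑ k : ZMod N, ∑ l : ZMod N, (if k = l ∨ k = -l then ∑ z ∈ S, χ ((k - l) * z) else 0) =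
      N * S.card + N * (S.filter fun z => 2 * z = 0).card -
        (Finset.univ.filter fun k : ZMod N => 2 * k = 0).card * S.card := by
  have h : ∀ k l : ZMod N, (if k = l ∨ k = -l then ∑ z ∈ S, χ ((k - l) * z) else 0) =
      (if k = l then (S.card : ℂ) else 0) + (if -k = l then ∑ z ∈ S, χ (k * (2 * z)) else 0) -
        if k = l then (if 2 * k = 0 then (S.card : ℂ) else 0) else 0 := by
    intro k l
    have hk : -k = k ↔ 2 * k = 0 := by
      rw [neg_eq_iff_add_eq_zero, two_mul]
    have hl : k = -l ↔ -k = l := by rw [eq_comm, neg_eq_iff_eq_neg, eq_comm]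
    simp only [hl]
    by_cases h1 : k = l
    · subst h1
      by_cases h2 : 2 * k = 0
      · have : ∀ z, k * (2 * z) = 0 := fun z => by rw [mul_left_comm, ← mul_assoc, h2, zero_mul]
        simp [hk.2 h2, h2, this]
      · simp [hk, h2]
    · by_cases h2 : -k = l
      · subst h2
        simp only [h1, false_or, if_true, if_false, zero_add, sub_zero]
        refine Finset.sum_congr rfl fun z _ => ?_
        congr 1; ring
      · simp [h1, h2]
  simp only [h, Finset.sum_sub_distrib, Finset.sum_add_distrib, Finset.sum_ite_eq, Finset.mem_univ,
    if_true]
  rw [Finset.sum_comm (t := S)]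
  simp only [sum_stdAddChar_mul]
  rw [← Finset.sum_filter, ← Finset.sum_filter]
  simp [mul_comm, ZMod.card]

/-! ### Decoupling the double sum over momenta -/

lemma sum_eq_sum_range {E : Type*} [AddCommMonoid E] (F : ZMod N → E) :
    ∑ l, F l = ∑ j ∈ Finset.range N, F (j : ZMod N) := by
  refine Finset.sum_nbij' (fun l => l.val) (fun j => (j : ZMod N)) ?_ ?_ ?_ ?_ ?_
  · intro l _; exact Finset.mem_range.2 (ZMod.val_lt l)
  · intro j _; exact Finset.mem_univ _
  · intro l _; exact ZMod.natCast_zmod_val l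
  · intro j hj; exact ZMod.val_cast_of_lt (Finset.mem_range.1 hj)
  · intro l _; rw [ZMod.natCast_zmod_val]

/-- The numbers `2j` with `j < N` are distinct and lie below `2N`, an interval that covers the
cyclic group twice. This handles doubling, which need not be injective modulo `N`. -/
lemma sum_shift_two_mul_le {G : ZMod N → ℝ} (hG : ∀ d, 0 ≤ G d) (d : ZMod N) :
    ∑ l, G (d + 2 * l) ≤ 2 * ∑ s, G s := by
  have hs : ∑ j ∈ Finset.range N, G (d + j) = ∑ s, G s := by
    rw [← sum_eq_sum_range fun l => G (d + l)]
    exact Equiv.sum_comp (Equiv.addLeft d) G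
  calc ∑ l, G (d + 2 * l) = ∑ j ∈ Finset.range N, G (d + ((2 * j : ℕ) : ZMod N)) := by
        rw [sum_eq_sum_range]; simp only [Nat.cast_mul, Nat.cast_ofNat]
    _ = ∑ j ∈ (Finset.range N).image (fun i : ℕ => 2 * i), G (d + (j : ZMod N)) := by
        rw [Finset.sum_image (by intro a _ b _ h; exact Nat.mul_left_cancel two_pos h)]
    _ ≤ ∑ j ∈ Finset.range (N + N), G (d + (j : ZMod N)) := by
        refine Finset.sum_le_sum_of_subset_of_nonneg ?_ fun _ _ _ => hG _
        intro j hj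
        simp only [Finset.mem_image, Finset.mem_range] at hj ⊢
        omega
    _ = 2 * ∑ s, G s := by
        rw [Finset.sum_range_add, hs]
        simp only [Nat.cast_add, ZMod.natCast_self, zero_add]
        rw [hs, two_mul]

/-- With `d = k - l` the other variable is `k + l = d + 2l`, and the sum over `l` costs at most a
factor of two. -/
lemma sum_sub_add_le {F G : ZMod N → ℝ} (hF : ∀ d, 0 ≤ F d) (hG : ∀ d, 0 ≤ G d) :
    ∑ k, ∑ l, F (k - l) * G (k + l) ≤ 2 * (∑ d, F d) * ∑ s, G s := by
  rw [Finset.sum_comm]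
  have h : ∀ l, ∑ k, F (k - l) * G (k + l) = ∑ d, F d * G (d + 2 * l) := by
    intro l
    rw [← (Equiv.subRight l).sum_comp fun d => F d * G (d + 2 * l)]
    refine Finset.sum_congr rfl fun k _ => ?_
    rw [Equiv.subRight_apply]
    congr 2; ring
  rw [Finset.sum_congr rfl fun l _ => h l, Finset.sum_comm, mul_right_comm, mul_comm, Finset.sum_mul]
  refine Finset.sum_le_sum fun d _ => ?_
  rw [← Finset.mul_sum]
  exact mul_le_mul_of_nonneg_left (sum_shift_two_mul_le hG d) (hF d)

lemma abs_average_sub_le (S : Finset (ZMod N)) {T : ℝ} (hT : 0 < T)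
    (hS : ∀ d : ZMod N, d ≠ 0 → ‖∑ z ∈ S, χ (d * z)‖ ≤ 2 / chord d) :
    |1 / T * (∫ τ in (0 : ℝ)..T, walkProbability S τ) -
      ((N : ℝ) * S.card + N * (S.filter fun z => 2 * z = 0).card -
        (Finset.univ.filter fun k : ZMod N => 2 * k = 0).card * S.card) / N ^ 2| ≤
      16 / (N ^ 2 * T) * (∑ d : ZMod N, (chord d)⁻¹ ^ 2) * ∑ s : ZMod N, (chord s)⁻¹ := by
  rw [← Real.norm_eq_abs, ← Complex.norm_real, Complex.ofReal_sub, average_walkProbability]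
  have hst := sum_stationary S
  have hN : (0 : ℝ) < N := Nat.cast_pos.2 (NeZero.pos N)
  have e : (((((N : ℝ) * S.card + N * (S.filter fun z => 2 * z = 0).card -
        (Finset.univ.filter fun k : ZMod N => 2 * k = 0).card * S.card) / N ^ 2 : ℝ)) : ℂ) =
      ((N : ℂ) ^ 2)⁻¹ * ∑ k : ZMod N, ∑ l : ZMod N,
        (if k = l ∨ k = -l then ∑ z ∈ S, χ ((k - l) * z) else 0) := by
    rw [hst]; push_cast; ring
  rw [e, ← mul_sub, ← Finset.sum_sub_distrib, norm_mul]
  simp only [← Finset.sum_sub_distrib]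
  have hn : ‖((N : ℂ) ^ 2)⁻¹‖ = ((N : ℝ) ^ 2)⁻¹ := by simp
  rw [hn]
  have hF := chord_nonneg (N := N)
  calc _ ≤ ((N : ℝ) ^ 2)⁻¹ * ∑ k : ZMod N, ∑ l : ZMod N,
        8 / T * ((chord (k - l))⁻¹ ^ 2 * (chord (k + l))⁻¹) := by
        gcongr
        refine norm_sum_le_of_le _ fun k _ => norm_sum_le_of_le _ fun l _ => ?_
        exact norm_average_sub_le S hT hS k l
    _ = ((N : ℝ) ^ 2)⁻¹ * (8 / T * ∑ k : ZMod N, ∑ l : ZMod N,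
        ((chord (k - l))⁻¹ ^ 2 * (chord (k + l))⁻¹)) := by
        simp only [Finset.mul_sum]
    _ ≤ ((N : ℝ) ^ 2)⁻¹ * (8 / T * (2 * (∑ d : ZMod N, (chord d)⁻¹ ^ 2) *
          ∑ s : ZMod N, (chord s)⁻¹)) := by
        gcongr
        exact sum_sub_add_le (F := fun d => (chord d)⁻¹ ^ 2) (G := fun d => (chord d)⁻¹)
          (fun d => by positivity) (fun d => inv_nonneg.2 (hF d))
    _ = _ := by
        rw [div_eq_mul_inv, div_eq_mul_inv, mul_inv]; ring

/-! ### Trigonometric sums -/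

/-- The chord is `2 |sin (πd/N)|`, and `sin x ≥ 2x/π` on `[0, π/2]`; residues in the upper half are
reflected to `N - d`. -/
lemma le_chord (d : ZMod N) :
    4 * (d.val : ℝ) / N ≤ chord d ∨ 4 * ((N - d.val : ℕ) : ℝ) / N ≤ chord d := by
  have hN : (0 : ℝ) < N := Nat.cast_pos.2 (NeZero.pos N)
  have hv := ZMod.val_lt d
  have hc : chord d = |2 * Real.sin (Real.pi * d.val / N)| := by
    have h := ZMod.stdAddChar_coe (N := N) (d.val : ℤ)
    rw [Int.cast_natCast, ZMod.natCast_zmod_val] at h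
    have e : 2 * (Real.pi : ℂ) * Complex.I * ((d.val : ℤ) : ℂ) / N =
        Complex.I * ((2 * (Real.pi * d.val / N) : ℝ) : ℂ) := by
      push_cast; ring
    rw [chord, h, e, Complex.norm_exp_I_mul_ofReal_sub_one, mul_div_cancel_left₀ _ two_ne_zero,
      Real.norm_eq_abs]
  have key : ∀ v : ℝ, 0 ≤ v → 2 * v ≤ N → 4 * v / N ≤ |2 * Real.sin (Real.pi * v / N)| := by
    intro v h0 h1
    have h2 : Real.pi * v / N ≤ Real.pi / 2 := by
      rw [div_le_div_iff₀ hN two_pos]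
      nlinarith [Real.pi_pos]
    have h3 := Real.mul_le_sin (by positivity) h2
    have h4 : 2 / Real.pi * (Real.pi * v / N) = 2 * v / N := by
      field_simp [Real.pi_ne_zero]
    rw [h4] at h3
    refine le_trans ?_ (le_abs_self _)
    have h5 : 4 * v / N = 2 * (2 * v / N) := by ring
    rw [h5]
    linarith
  rw [hc]
  by_cases h : 2 * d.val ≤ N
  · exact Or.inl (key _ (Nat.cast_nonneg _) (by exact_mod_cast h))
  · right
    have h1 := key ((N - d.val : ℕ) : ℝ) (Nat.cast_nonneg _)
      (by exact_mod_cast (by omega : 2 * (N - d.val) ≤ N))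
    have h2 : Real.pi * ((N - d.val : ℕ) : ℝ) / N = Real.pi - Real.pi * d.val / N := by
      rw [Nat.cast_sub hv.le]; field_simp
    rwa [h2, Real.sin_pi_sub] at h1

/-- The two cases of `le_chord` are replaced by a sum, which bounds either one. At `d = 0` the left
side is `0⁻¹ ^ e = 0`, because `e ≠ 0`. -/
lemma inv_chord_pow_le (e : ℕ) (he : e ≠ 0) (d : ZMod N) :
    (chord d)⁻¹ ^ e ≤
      ((N : ℝ) / 4) ^ e * (((d.val : ℝ)⁻¹) ^ e + (((N - d.val : ℕ) : ℝ)⁻¹) ^ e) := by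
  have hN : (0 : ℝ) < N := Nat.cast_pos.2 (NeZero.pos N)
  by_cases hd : d = 0
  · rw [(chord_eq_zero_iff d).2 hd, inv_zero, zero_pow he]
    positivity
  · have hv : 0 < d.val := Nat.pos_of_ne_zero (by rwa [Ne, ZMod.val_eq_zero])
    have hv' : 0 < N - d.val := Nat.sub_pos_of_lt (ZMod.val_lt d)
    have key : ∀ v : ℝ, 0 < v → 4 * v / N ≤ chord d →
        (chord d)⁻¹ ^ e ≤ ((N : ℝ) / 4) ^ e * (v⁻¹) ^ e := by
      intro v h0 h
      rw [← mul_pow]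
      refine pow_le_pow_left₀ (inv_nonneg.2 (chord_nonneg d)) ?_ e
      refine (inv_anti₀ (by positivity) h).trans (le_of_eq ?_)
      rw [inv_div, mul_comm 4 v, ← div_div, div_right_comm, div_eq_mul_inv]
    rw [mul_add]
    rcases le_chord d with h | h
    · exact (key _ (by exact_mod_cast hv) h).trans (le_add_of_nonneg_right (by positivity))
    · exact (key _ (by exact_mod_cast hv') h).trans (le_add_of_nonneg_left (by positivity))

lemma sum_inv_chord_pow_le (e : ℕ) (he : e ≠ 0) :
    ∑ d : ZMod N, (chord d)⁻¹ ^ e ≤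
      ((N : ℝ) / 4) ^ e * (2 * ∑ j ∈ Finset.range N, (((j + 1 : ℕ) : ℝ)⁻¹) ^ e) := by
  refine (Finset.sum_le_sum fun d _ => inv_chord_pow_le e he d).trans ?_
  rw [← Finset.mul_sum, Finset.sum_add_distrib, two_mul]
  gcongr ?_ * (?_ + ?_)
  · rw [sum_eq_sum_range fun d : ZMod N => ((d.val : ℝ)⁻¹) ^ e]
    calc ∑ j ∈ Finset.range N, (((j : ZMod N).val : ℝ)⁻¹) ^ e
        = ∑ j ∈ Finset.range N, ((j : ℝ)⁻¹) ^ e :=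
          Finset.sum_congr rfl fun j hj => by rw [ZMod.val_cast_of_lt (Finset.mem_range.1 hj)]
      -- A term `j = N` is added and the vanishing term `j = 0` dropped, so that the sum runs over
      -- `1, …, N`, as for the reflected half.
      _ ≤ ∑ j ∈ Finset.range (N + 1), ((j : ℝ)⁻¹) ^ e := by
          rw [Finset.sum_range_succ]
          exact le_add_of_nonneg_right (by positivity)
      _ = _ := by
          rw [Finset.sum_range_succ']; simp [he]
  · rw [sum_eq_sum_range fun d : ZMod N => ((((N - d.val : ℕ) : ℝ))⁻¹) ^ e,
      ← Finset.sum_range_reflect]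
    refine le_of_eq (Finset.sum_congr rfl fun j hj => ?_)
    have := Finset.mem_range.1 hj
    rw [ZMod.val_cast_of_lt (by omega)]
    congr 3
    omega

lemma sum_inv_chord_le : ∑ d : ZMod N, (chord d)⁻¹ ≤ N / 2 * (1 + Real.log N) := by
  have h := sum_inv_chord_pow_le (N := N) 1 one_ne_zero
  have h2 := harmonic_le_one_add_log N
  simp only [harmonic, Rat.cast_sum, Rat.cast_inv, Rat.cast_natCast] at h2
  simp only [pow_one] at h
  refine h.trans ((mul_le_mul_of_nonneg_left (mul_le_mul_of_nonneg_left h2 two_pos.le)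
    (by positivity)).trans (le_of_eq (by ring)))

lemma sum_inv_chord_sq_le : ∑ d : ZMod N, (chord d)⁻¹ ^ 2 ≤ (N : ℝ) ^ 2 / 4 := by
  have h := sum_inv_chord_pow_le (N := N) 2 two_ne_zero
  have h2 : ∑ j ∈ Finset.range N, (((j + 1 : ℕ) : ℝ)⁻¹) ^ 2 ≤ 2 := by
    have h3 := sum_Ioo_inv_sq_le (α := ℝ) 0 (N + 1)
    have h4 : ∑ j ∈ Finset.range N, (((j + 1 : ℕ) : ℝ)⁻¹) ^ 2 =
        ∑ i ∈ Finset.Ioo 0 (N + 1), ((i : ℝ) ^ 2)⁻¹ := by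
      simp only [inv_pow]
      rw [← Finset.sum_image (f := fun i : ℕ => ((i : ℝ) ^ 2)⁻¹) (g := fun j => j + 1)
        (by intro a _ b _ h; exact Nat.succ_injective h)]
      · refine Finset.sum_congr ?_ fun _ _ => rfl
        ext i
        simp only [Finset.mem_image, Finset.mem_range, Finset.mem_Ioo]
        constructor
        · rintro ⟨j, hj, rfl⟩; omega
        · intro hi; exact ⟨i - 1, by omega, by omega⟩
    rw [h4]
    simpa using h3
  refine h.trans ((mul_le_mul_of_nonneg_left (mul_le_mul_of_nonneg_left h2 two_pos.le)
    (by positivity)).trans (le_of_eq (by ring)))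

/-! ### The region far from the start -/

/-- The sites of a cycle of length `6 M` at distance at least `M` from `0`. -/
def farRegion (M : ℕ) : Finset (ZMod N) :=
  Finset.univ.filter fun z => M ≤ z.val ∧ z.val ≤ 5 * M

lemma sum_farRegion {M : ℕ} (hN : N = 6 * M) {E : Type*} [AddCommMonoid E]
    (F : ZMod N → E) :
    ∑ z ∈ farRegion M, F z = ∑ j ∈ Finset.Ico M (5 * M + 1), F (j : ZMod N) := by
  have hpos := NeZero.pos N
  refine Finset.sum_nbij' (fun l => l.val) (fun j => (j : ZMod N)) ?_ ?_ ?_ ?_ ?_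
  · intro l hl
    have := (Finset.mem_filter.1 hl).2
    rw [Finset.mem_Ico]; omega
  · intro j hj
    rw [Finset.mem_Ico] at hj
    refine Finset.mem_filter.2 ⟨Finset.mem_univ _, ?_⟩
    rw [ZMod.val_cast_of_lt (by omega)]; omega
  · intro l _; exact ZMod.natCast_zmod_val l
  · intro j hj
    rw [Finset.mem_Ico] at hj
    exact ZMod.val_cast_of_lt (by omega)
  · intro l _; rw [ZMod.natCast_zmod_val]

lemma card_farRegion {M : ℕ} (hN : N = 6 * M) :
    (farRegion M : Finset (ZMod N)).card = 4 * M + 1 := by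
  rw [Finset.card_eq_sum_ones, sum_farRegion hN, ← Finset.card_eq_sum_ones, Nat.card_Ico]
  omega

lemma two_mul_eq_zero_iff {M : ℕ} (hN : N = 6 * M) (z : ZMod N) :
    2 * z = 0 ↔ z = 0 ∨ z = ((3 * M : ℕ) : ZMod N) := by
  have hpos := NeZero.pos N
  constructor
  · intro h
    have hv := ZMod.val_lt z
    have h1 : ((2 * z.val : ℕ) : ZMod N) = 0 := by
      rw [Nat.cast_mul, ZMod.natCast_zmod_val]; exact_mod_cast h
    rw [ZMod.natCast_eq_zero_iff] at h1
    obtain ⟨c, hc⟩ := h1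
    have hc2 : c < 2 := by
      by_contra hc'
      have := Nat.mul_le_mul_left N (not_lt.1 hc')
      omega
    rw [← ZMod.natCast_zmod_val z]
    interval_cases c
    · left
      rw [(by omega : z.val = 0), Nat.cast_zero]
    · right
      congr 1; omega
  · rintro (rfl | rfl)
    · exact mul_zero _
    · have : (2 : ZMod N) * ((3 * M : ℕ) : ZMod N) = ((6 * M : ℕ) : ZMod N) := by
        push_cast; ring
      rw [this, ← hN, ZMod.natCast_self]

/-- The start and its antipode `3M`; only the antipode lies in the far region. -/
lemma card_two_torsion {M : ℕ} (hN : N = 6 * M) :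
    (Finset.univ.filter fun z : ZMod N => 2 * z = 0).card = 2 := by
  have hpos := NeZero.pos N
  have h : (Finset.univ.filter fun z : ZMod N => 2 * z = 0) = {0, ((3 * M : ℕ) : ZMod N)} := by
    ext z; simp only [Finset.mem_filter, Finset.mem_univ, true_and, two_mul_eq_zero_iff hN,
      Finset.mem_insert, Finset.mem_singleton]
  rw [h, Finset.card_pair]
  intro e
  have := congrArg ZMod.val e
  rw [ZMod.val_zero, ZMod.val_cast_of_lt (by omega)] at this
  omega

lemma card_farRegion_two_torsion {M : ℕ} (hN : N = 6 * M) :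
    ((farRegion M : Finset (ZMod N)).filter fun z => 2 * z = 0).card = 1 := by
  have hpos := NeZero.pos N
  rw [Finset.card_eq_one]
  refine ⟨((3 * M : ℕ) : ZMod N), ?_⟩
  ext z
  simp only [Finset.mem_filter, farRegion, Finset.mem_univ, true_and, two_mul_eq_zero_iff hN,
    Finset.mem_singleton]
  constructor
  · rintro ⟨h, rfl | h'⟩
    · rw [ZMod.val_zero] at h; omega
    · exact h'
  · rintro rfl
    rw [ZMod.val_cast_of_lt (by omega)]
    exact ⟨by omega, Or.inr rfl⟩

/-- The region is an interval of consecutive sites, so this is a geometric sum with numerator at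
most `2`. -/
lemma norm_sum_farRegion_le {M : ℕ} (hN : N = 6 * M) (d : ZMod N) (hd : d ≠ 0) :
    ‖∑ z ∈ farRegion M, χ (d * z)‖ ≤ 2 / chord d := by
  have h1 : χ d ≠ 1 := fun h => hd ((stdAddChar_eq_one_iff d).1 h)
  have h2 : ∀ j : ℕ, χ (d * j) = χ d ^ j := by
    intro j; rw [← AddChar.map_nsmul_eq_pow, nsmul_eq_mul, mul_comm]
  rw [sum_farRegion hN]
  simp only [h2]
  rw [geom_sum_Ico h1 (by omega), norm_div, chord]
  gcongr
  refine (norm_sub_le _ _).trans (le_of_eq ?_)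
  rw [norm_pow, norm_pow, norm_stdAddChar, one_pow, one_pow]
  norm_num

lemma average_farRegion {M : ℕ} (hN : N = 6 * M) {T : ℝ} (hT : 0 < T) :
    2 / 3 - 1 / (3 * N) - 4 * (N * Real.log N ^ 2) / T ≤
        1 / T * ∫ τ in (0 : ℝ)..T, walkProbability (farRegion M : Finset (ZMod N)) τ ∧
      1 / T * ∫ τ in (0 : ℝ)..T, walkProbability (farRegion M : Finset (ZMod N)) τ ≤
        2 / 3 + 2 / (3 * N) + 4 * (N * Real.log N ^ 2) / T := by
  have hpos : (0 : ℝ) < N := Nat.cast_pos.2 (NeZero.pos N)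
  have hM : (6 * (M : ℝ)) = N := by rw [hN]; push_cast; ring
  have hN6 : (6 : ℝ) ≤ N := by
    have := NeZero.pos N
    exact_mod_cast (by omega : 6 ≤ N)
  -- Since `N ≥ 6 > e`; this permits replacing `1 + log N` by `2 log² N`.
  have hlog : 1 ≤ Real.log N := by
    rw [Real.le_log_iff_exp_le hpos]
    linarith [Real.exp_one_lt_d9]
  have h := abs_average_sub_le (farRegion M : Finset (ZMod N)) hT (norm_sum_farRegion_le hN)
  rw [card_farRegion hN, card_farRegion_two_torsion hN, card_two_torsion hN] at h
  have hmain : ((N : ℝ) * ((4 * M + 1 : ℕ) : ℝ) + N * ((1 : ℕ) : ℝ) -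
      ((2 : ℕ) : ℝ) * ((4 * M + 1 : ℕ) : ℝ)) / N ^ 2 = 2 / 3 + 2 / (3 * N) - 2 / N ^ 2 := by
    push_cast
    rw [show (M : ℝ) = N / 6 by linarith]
    field_simp
    ring
  rw [hmain] at h
  have herr : 16 / ((N : ℝ) ^ 2 * T) * (∑ d : ZMod N, (chord d)⁻¹ ^ 2) * ∑ s : ZMod N, (chord s)⁻¹ ≤
      4 * (N * Real.log N ^ 2) / T := by
    have hs : 0 ≤ ∑ s : ZMod N, (chord s)⁻¹ :=
      Finset.sum_nonneg fun s _ => inv_nonneg.2 (chord_nonneg s)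
    calc _ ≤ 16 / ((N : ℝ) ^ 2 * T) * ((N : ℝ) ^ 2 / 4) * (N / 2 * (1 + Real.log N)) := by
          gcongr
          · exact sum_inv_chord_sq_le
          · exact sum_inv_chord_le
      -- The estimate so far has a single logarithm; the second is given away in the next step.
      _ = 2 * (N * (1 + Real.log N)) / T := by field_simp; ring
      _ ≤ 4 * (N * Real.log N ^ 2) / T := by
          refine div_le_div_of_nonneg_right ?_ hT.le
          have : 1 + Real.log N ≤ 2 * Real.log N ^ 2 := by nlinarith
          calc 2 * (N * (1 + Real.log N)) ≤ 2 * (N * (2 * Real.log N ^ 2)) := by gcongr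
            _ = _ := by ring
  -- The exact stationary value contains `-2/N²`. It is absorbed into the lower bound by passing
  -- from `+2/(3N)` to `-1/(3N)`, and dropped in the upper bound.
  have hsmall : 2 / (N : ℝ) ^ 2 ≤ 2 / (3 * N) + 1 / (3 * N) := by
    rw [← add_div, div_le_div_iff₀ (by positivity) (by positivity)]
    nlinarith
  have hsq : 0 ≤ 2 / (N : ℝ) ^ 2 := by positivity
  obtain ⟨hl, hu⟩ := abs_le.1 (h.trans herr)
  constructor <;> linarith

end Waves

end

noncomputable section

variable {n : ℕ} (C : Circuit n)

/-! ### Invariance of the legal subspace -/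

lemma hamiltonian_conjTranspose : (hamiltonian C)ᴴ = hamiltonian C := by
  rw [hamiltonian, Matrix.conjTranspose_sum]
  exact Finset.sum_congr rfl fun i _ => (isStarProjection_term C i).isSelfAdjoint

section Subspace

variable (φ₀ : StateVec (Fin n))

lemma legalState_mem (p : Place C) : legalState C φ₀ p ∈ legalSubspace C φ₀ :=
  Submodule.subset_span ⟨p, rfl⟩

lemma hamiltonian_mulVec_mem {v : StateVec (Qubit C)} (hv : v ∈ legalSubspace C φ₀) :
    hamiltonian C *ᵥ v ∈ legalSubspace C φ₀ := by
  have h : legalSubspace C φ₀ ≤ (legalSubspace C φ₀).comap (hamiltonian C).mulVecLin := by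
    refine Submodule.span_le.2 ?_
    rintro _ ⟨p, rfl⟩
    change hamiltonian C *ᵥ legalState C φ₀ p ∈ legalSubspace C φ₀
    rw [hamiltonian_mulVec_legalState]
    refine Submodule.sum_mem _ fun e _ => Submodule.smul_mem _ _ (Submodule.smul_mem _ _ ?_)
    exact Submodule.sub_mem _ (legalState_mem C φ₀ _) (legalState_mem C φ₀ _)
  exact h hv

/-- A self-adjoint operator that preserves a subspace preserves its orthogonal complement. -/
lemma orthogonal_hamiltonian_mulVec {v : StateVec (Qubit C)}
    (hv : ∀ u ∈ legalSubspace C φ₀, star u ⬝ᵥ v = 0) :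
    ∀ u ∈ legalSubspace C φ₀, star u ⬝ᵥ (hamiltonian C *ᵥ v) = 0 := by
  intro u hu
  rw [← hv _ (hamiltonian_mulVec_mem C φ₀ hu), Matrix.star_mulVec, hamiltonian_conjTranspose,
    Matrix.dotProduct_mulVec]

lemma startState_eq_legalState :
    startState C φ₀ = legalState C φ₀ (placeOf C (station C false 0)) :=
  (legalState_placeOf_station C φ₀ false 0).symm

lemma startState_eq_cycleState (hC : C ≠ []) : startState C φ₀ = cycleState C hC φ₀ 0 := by
  rw [startState_eq_legalState, legalState_eq_cycleState C hC, cyclicPosition_station]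
  simp [foldTime, lineTime_zero]

variable {φ₀} in
lemma star_historyState_dotProduct (hC : C ≠ []) (hφ : star φ₀ ⬝ᵥ φ₀ = 1) :
    star (historyState C φ₀) ⬝ᵥ historyState C φ₀ = 1 := by
  have hN : (0 : ℝ) < cycleLength C := by
    have := computationTime_pos hC
    have : 0 < cycleLength C := by unfold cycleLength; omega
    exact_mod_cast this
  have h : star (∑ p, legalState C φ₀ p) ⬝ᵥ ∑ p, legalState C φ₀ p = (cycleLength C : ℂ) := by
    rw [star_sum, sum_dotProduct]
    simp only [dotProduct_sum, star_legalState_dotProduct C φ₀ hφ, Finset.sum_ite_eq,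
      Finset.mem_univ, if_true, Finset.sum_const, nsmul_eq_mul, mul_one]
    rw [Finset.card_univ, card_place C hC]
  rw [historyState, star_smul, smul_dotProduct, dotProduct_smul, h, smul_eq_mul, smul_eq_mul,
    ← mul_assoc]
  simp only [Complex.star_def, Complex.conj_ofReal]
  rw [← Complex.ofReal_mul, div_mul_div_comm, one_mul, Real.mul_self_sqrt hN.le]
  push_cast
  have : (cycleLength C : ℂ) ≠ 0 := by exact_mod_cast hN.ne'
  field_simp

end Subspace

/-! ### The end of the computation -/

lemma workState_eq_foldl (φ₀ : StateVec (Fin n)) {t : ℕ} (ht : t ≤ C.length) :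
    workState C φ₀ t = (C.take t).foldl (fun V g => g.op * V) 1 *ᵥ φ₀ := by
  induction t with
  | zero => simp [workState]
  | succ t ih =>
    rw [workState_succ C φ₀ ⟨t, ht⟩, ih (by omega), List.take_succ_eq_append_getElem ht,
      List.foldl_append, List.foldl_cons, List.foldl_nil, Matrix.mulVec_mulVec]
    rfl

lemma workState_of_le (φ₀ : StateVec (Fin n)) {t : ℕ} (ht : C.length ≤ t) :
    workState C φ₀ t = circuitUnitary C *ᵥ φ₀ := by
  induction t, ht using Nat.le_induction with
  | base => rw [workState_eq_foldl C φ₀ le_rfl, List.take_length, circuitUnitary]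
  | succ t ht ih => rw [workState_succ_of_le C φ₀ ht, ih]

lemma length_le_of_computationTime_le {t : ℕ} (h : computationTime C ≤ lineTime C t) :
    C.length ≤ t := by
  rw [← lineTime_length] at h
  exact (lineTime_strictMono C).le_iff_le.1 h

/-! ### The success region -/

/-- In the primed copy the position is `6M` minus the distance, so distance at least `M` becomes
position at most `5M`. The other inequality is automatic, as distances never exceed `3M`. -/
lemma inSuccessRegion_iff (c : ClockQubit C) : InSuccessRegion C c ↔
    computationTime C ≤ cyclePosition C (placeOf C c) ∧
      cyclePosition C (placeOf C c) ≤ 5 * computationTime C := by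
  have hN : cycleLength C = 2 * (3 * computationTime C) := rfl
  obtain ⟨⟨b, t⟩, ht⟩ | ⟨b, s, k, i⟩ := c
  · have hle := lineTime_le C t
    cases b
    · simp only [InSuccessRegion, distanceFromStart, placeOf, cyclePosition, Bool.false_eq_true,
        if_false]
      omega
    · simp only [InSuccessRegion, distanceFromStart, placeOf, cyclePosition, if_true]
      omega
  · have h1 := lineTime_switch C s
    have h2 := lineTime_succ_le C s.1
    cases b
    · simp only [InSuccessRegion, distanceFromStart, placeOf, cyclePosition, Bool.false_eq_true,
        if_false]
      omega
    · simp only [InSuccessRegion, distanceFromStart, placeOf, cyclePosition, if_true]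
      omega

lemma successOutcome_iff {x : Qubit C → Fin 2} {c : ClockQubit C}
    (h : (fun r => x (Sum.inr r)) = Pi.single c 1) : SuccessOutcome C x ↔ InSuccessRegion C c := by
  have hx : ∀ a, x (Sum.inr a) = 1 ↔ a = c := by
    intro a
    rw [show x (Sum.inr a) = (Pi.single c 1 : ClockQubit C → Fin 2) a from congrFun h a]
    by_cases hac : a = c
    · subst hac; simp
    · simp [hac]
  simp only [SuccessOutcome, hx, exists_eq_right]

lemma successOutcome_iff_of_legalState_ne_zero {φ₀ : StateVec (Fin n)} {p : Place C}
    {x : Qubit C → Fin 2} (h : legalState C φ₀ p x ≠ 0) :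
    SuccessOutcome C x ↔ computationTime C ≤ cyclePosition C p ∧
      cyclePosition C p ≤ 5 * computationTime C := by
  rw [legalState_eq_sum, Finset.sum_apply] at h
  obtain ⟨c, _, hc⟩ := Finset.exists_ne_zero_of_sum_ne_zero h
  by_cases hp : placeOf C c = p
  · rw [if_pos hp, withTrain] at hc
    by_cases hx : (fun r => x (Sum.inr r)) = Pi.single c 1
    · rw [successOutcome_iff C hx, inSuccessRegion_iff, hp]
    · rw [if_neg hx] at hc
      exact absurd rfl hc
  · rw [if_neg hp] at hc
    exact absurd rfl hc

variable [NeZero (cycleLength C)]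

lemma successOutcome_iff_mem_farRegion (hC : C ≠ []) (φ₀ : StateVec (Fin n))
    {z : ZMod (cycleLength C)} {x : Qubit C → Fin 2}
    (h : cycleState C hC φ₀ z x ≠ 0) :
    SuccessOutcome C x ↔ z ∈ farRegion (computationTime C) := by
  have hz : z.val = cyclePosition C ((placeEquiv C hC).symm z) := by
    conv_lhs => rw [← (placeEquiv C hC).apply_symm_apply z]
    exact ZMod.val_cast_of_lt (cyclePosition_lt C hC _)
  rw [successOutcome_iff_of_legalState_ne_zero C h, farRegion, Finset.mem_filter, hz]
  simp

lemma evolved_eq_sum (hC : C ≠ []) (φ₀ : StateVec (Fin n)) (τ : ℝ) :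
    evolved C φ₀ τ = ∑ z : ZMod (cycleLength C), amplitude τ z • cycleState C hC φ₀ z := by
  rw [evolved, startState_eq_cycleState C φ₀ hC]
  exact exp_mulVec_start (hamiltonian_mulVec_cycleState C hC φ₀) τ

/-- The support of each legal state lies entirely among the success outcomes or entirely outside.
The measurement therefore keeps exactly the cycle states over the far region, and orthonormality
turns the norm into a sum of squared amplitudes. -/
lemma successProbability_eq (hC : C ≠ []) {φ₀ : StateVec (Fin n)} (hφ : star φ₀ ⬝ᵥ φ₀ = 1)
    (τ : ℝ) : successProbability C φ₀ τ =
      walkProbability (farRegion (computationTime C) : Finset (ZMod (cycleLength C))) τ := by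
  classical
  set S := (farRegion (computationTime C) : Finset (ZMod (cycleLength C)))
  have h1 : ∀ x, (if SuccessOutcome C x then ‖evolved C φ₀ τ x‖ ^ 2 else 0) =
      ‖(∑ z ∈ S, amplitude τ z • cycleState C hC φ₀ z) x‖ ^ 2 := by
    intro x
    rw [evolved_eq_sum C hC, Finset.sum_apply, Finset.sum_apply]
    by_cases hx : SuccessOutcome C x
    · rw [if_pos hx]
      congr 2
      refine (Finset.sum_subset (Finset.subset_univ S) fun z _ hz => ?_).symm
      by_contra hne
      exact hz ((successOutcome_iff_mem_farRegion C hC φ₀ fun h => hne (by simp [h])).1 hx)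
    · rw [if_neg hx, Finset.sum_eq_zero, norm_zero, zero_pow two_ne_zero]
      intro z hz
      by_contra hne
      exact hx ((successOutcome_iff_mem_farRegion C hC φ₀ fun h => hne (by simp [h])).2 hz)
  have h2 : ∀ v : StateVec (Qubit C), ((∑ x, ‖v x‖ ^ 2 : ℝ) : ℂ) = star v ⬝ᵥ v := by
    intro v
    rw [Complex.ofReal_sum, dotProduct]
    refine Finset.sum_congr rfl fun x _ => ?_
    rw [Complex.ofReal_pow, ← Complex.conj_mul']
    rfl
  have h3 : ∀ z w, star (cycleState C hC φ₀ z) ⬝ᵥ cycleState C hC φ₀ w = if z = w then 1 else 0 := by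
    intro z w
    rw [cycleState, cycleState, star_legalState_dotProduct C φ₀ hφ]
    simp only [EmbeddingLike.apply_eq_iff_eq]
  apply Complex.ofReal_injective
  rw [successProbability]
  simp only [h1]
  rw [h2, walkProbability, star_sum, sum_dotProduct, Complex.ofReal_sum]
  refine Finset.sum_congr rfl fun z hz => ?_
  simp only [dotProduct_sum, star_smul, smul_dotProduct, dotProduct_smul, h3, smul_eq_mul,
    mul_ite, mul_one, mul_zero, Finset.sum_ite_eq, if_pos hz]
  rw [Complex.ofReal_pow, ← Complex.mul_conj']
  rfl

/-- Each CNOT finishes by clock step `M`, so its rails lie strictly before the success region; every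
station in the region comes after the last gate of the circuit and carries `U φ₀`. -/
lemma exists_evolved_eq_mul (hC : C ≠ []) (φ₀ : StateVec (Fin n)) (τ : ℝ) :
    ∃ χ : (ClockQubit C → Fin 2) → ℂ, ∀ x, SuccessOutcome C x →
    evolved C φ₀ τ x =
      (circuitUnitary C *ᵥ φ₀) (fun q => x (Sum.inl q)) * χ (fun c => x (Sum.inr c)) := by
  -- All stations may be included in the clock vector: on a success outcome, a nonzero indicator
  -- already places its station in the region.
  refine ⟨fun y => ∑ t : Station C, if y = Pi.single (Sum.inl t) 1 then
    amplitude τ (cyclicPosition C (Sum.inl t)) else 0, fun x hx => ?_⟩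
  have h : evolved C φ₀ τ x =
      ∑ p, amplitude τ (cyclicPosition C p) * legalState C φ₀ p x := by
    rw [evolved_eq_sum C hC, Finset.sum_apply]
    refine (Fintype.sum_bijective _ (cyclicPosition_bijective C hC) _ _ fun p => ?_).symm
    rw [legalState_eq_cycleState C hC]
    rfl
  rw [h, Fintype.sum_sum_type, Finset.sum_eq_zero (s := (Finset.univ : Finset (Bool × _ × _))),
    add_zero, Finset.mul_sum]
  · refine Finset.sum_congr rfl fun t _ => ?_
    change _ * withTrain C (workState C φ₀ t.1.2) (Sum.inl t) x = _
    rw [withTrain]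
    by_cases hc : (fun c => x (Sum.inr c)) = Pi.single (Sum.inl t) 1
    · have ht : computationTime C ≤ lineTime C t.1.2 := (successOutcome_iff C hc).1 hx
      rw [if_pos hc, if_pos hc, workState_of_le C φ₀ (length_le_of_computationTime_le C ht),
        mul_comm]
    · rw [if_neg hc, if_neg hc, mul_zero, mul_zero]
  · rintro ⟨b, s, i⟩ _
    by_cases h0 : legalState C φ₀ (Sum.inr (b, s, i)) x = 0
    · rw [h0, mul_zero]
    · have h1 := (successOutcome_iff_of_legalState_ne_zero C h0).1 hx
      have h2 := (inSuccessRegion_iff C (Sum.inr (b, s, 0, i))).2 h1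
      have h3 : computationTime C ≤ lineTime C s.1 + 1 + i := h2
      have h4 := lineTime_switch C s
      have h5 := lineTime_succ_le C s.1
      omega

end

/-! ### Bounds on the averaged success probability -/

section

variable {n : ℕ} {C : Circuit n} {φ₀ : StateVec (Fin n)}

lemma neZero_cycleLength (hC : C ≠ []) : NeZero (cycleLength C) :=
  ⟨by have := computationTime_pos hC; unfold cycleLength; omega⟩

lemma continuous_successProbability (hC : C ≠ []) (hφ : star φ₀ ⬝ᵥ φ₀ = 1) :
    Continuous (successProbability C φ₀) := by
  have := neZero_cycleLength hC
  rw [funext (successProbability_eq C hC hφ)]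
  exact continuous_walkProbability _

lemma averageSuccess_bounds (hC : C ≠ []) (hφ : star φ₀ ⬝ᵥ φ₀ = 1) {T : ℝ} (hT : 0 < T) :
    2 / 3 - 1 / (3 * cycleLength C) -
        4 * (cycleLength C * Real.log (cycleLength C) ^ 2) / T ≤ averageSuccess C φ₀ T ∧
      averageSuccess C φ₀ T ≤ 2 / 3 + 2 / (3 * cycleLength C) +
        4 * (cycleLength C * Real.log (cycleLength C) ^ 2) / T := by
  have := neZero_cycleLength hC
  rw [averageSuccess, funext (successProbability_eq C hC hφ)]
  exact average_farRegion (cycleLength_eq C) hT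

lemma abs_averageSuccess_sub_le (hC : C ≠ []) (hφ : star φ₀ ⬝ᵥ φ₀ = 1) {ε : ℝ} (hε : 0 < ε) {T : ℝ}
    (hT : 4 / ε * (cycleLength C * Real.log (cycleLength C) ^ 2) ≤ T) :
    |averageSuccess C φ₀ T - 2 / 3| ≤ ε + 2 / (3 * cycleLength C) := by
  have hN : (1 : ℝ) < cycleLength C := by
    have := computationTime_pos hC
    exact_mod_cast (by unfold cycleLength; omega : 1 < cycleLength C)
  have hlog := Real.log_pos hN
  have hX : 0 < (cycleLength C : ℝ) * Real.log (cycleLength C) ^ 2 := by positivity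
  have hT0 : 0 < T := lt_of_lt_of_le (by positivity) hT
  -- The choice `K = 4/ε` makes the error term at most `ε`; the stationary value then deviates from
  -- `2/3` by at most `2/(3N)` on either side.
  have herr : 4 * (cycleLength C * Real.log (cycleLength C) ^ 2) / T ≤ ε := by
    rw [div_mul_eq_mul_div, div_le_iff₀ hε] at hT
    rw [div_le_iff₀ hT0]
    linarith
  obtain ⟨h1, h2⟩ := averageSuccess_bounds hC hφ hT0
  have h3 : 1 / (3 * (cycleLength C : ℝ)) ≤ 2 / (3 * cycleLength C) := by
    gcongr
    norm_num
  rw [abs_le]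
  constructor <;> linarith

end

end RailroadSwitch

open RailroadSwitch in
theorem mainTheorem2 :
    -- the construction, for every circuit and every initial state of the work register
    (∀ (n : ℕ) (C : Circuit n), C ≠ [] →
      ∀ φ₀ : StateVec (Fin n), star φ₀ ⬝ᵥ φ₀ = 1 →
      -- `O(L)` qubits and `O(L)` terms
      numSingle C + numCnot C = C.length ∧
      Fintype.card (Qubit C) = n + 6 * numSingle C + 22 * numCnot C ∧
      Fintype.card (TermLabel C) = 6 * numSingle C + 24 * numCnot C ∧
      -- the terms are 3-local projectors
      (∀ i, IsStarProjection (term C i) ∧ IsLocal 3 (term C i)) ∧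
      -- frustration-freeness: the normalized history state is annihilated by every term
      star (historyState C φ₀) ⬝ᵥ historyState C φ₀ = 1 ∧
      (∀ i, term C i *ᵥ historyState C φ₀ = 0) ∧
      -- the initial state is legal
      startState C φ₀ ∈ legalSubspace C φ₀ ∧
      -- the legal subspace and its orthogonal complement are invariant
      (∀ v ∈ legalSubspace C φ₀, hamiltonian C *ᵥ v ∈ legalSubspace C φ₀) ∧
      (∀ v, (∀ u ∈ legalSubspace C φ₀, star u ⬝ᵥ v = 0) →
        ∀ u ∈ legalSubspace C φ₀, star u ⬝ᵥ (hamiltonian C *ᵥ v) = 0) ∧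
      -- the legal states are an orthonormal basis of the legal subspace
      (∀ p q, star (legalState C φ₀ p) ⬝ᵥ legalState C φ₀ q = if p = q then 1 else 0) ∧
      -- in this basis the Hamiltonian is `1 - B/2`, with `B` the adjacency matrix of a cycle
      (∃ e : Place C ≃ Fin (cycleLength C), (∀ p, (e p : ℕ) = cyclePosition C p) ∧
        ∀ q, hamiltonian C *ᵥ legalState C φ₀ q =
          ∑ p, (1 - (1 / 2 : ℂ) • (SimpleGraph.cycleGraph (cycleLength C)).adjMatrix ℂ :
            Matrix (Fin (cycleLength C)) (Fin (cycleLength C)) ℂ) (e p) (e q) •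
              legalState C φ₀ p) ∧
      -- after finding the train in the success region, the work register is in the state `U φ₀`
      (∀ τ : ℝ, ∃ χ : (ClockQubit C → Fin 2) → ℂ, ∀ x, SuccessOutcome C x →
        evolved C φ₀ τ x =
          (circuitUnitary C *ᵥ φ₀) (fun q => x (Sum.inl q)) * χ (fun c => x (Sum.inr c))) ∧
      Continuous (successProbability C φ₀)) ∧
    -- the success probability at a uniformly random time in `[0, T]`
    (∃ K : ℝ, 0 < K ∧
      ∀ (n : ℕ) (C : Circuit n), C ≠ [] →
      ∀ φ₀ : StateVec (Fin n), star φ₀ ⬝ᵥ φ₀ = 1 → ∀ T : ℝ, 0 < T →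
        2 / 3 - 1 / (3 * cycleLength C) -
            K * (cycleLength C * Real.log (cycleLength C) ^ 2) / T ≤ averageSuccess C φ₀ T ∧
        averageSuccess C φ₀ T ≤ 2 / 3 + 2 / (3 * cycleLength C) +
            K * (cycleLength C * Real.log (cycleLength C) ^ 2) / T) ∧
    -- a running time `O(L log² L)` suffices for a success probability close to `2/3`
    (∀ ε : ℝ, 0 < ε → ∃ K : ℝ, 0 < K ∧
      ∀ (n : ℕ) (C : Circuit n), C ≠ [] →
      ∀ φ₀ : StateVec (Fin n), star φ₀ ⬝ᵥ φ₀ = 1 →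
      ∀ T : ℝ, K * (cycleLength C * Real.log (cycleLength C) ^ 2) ≤ T →
        |averageSuccess C φ₀ T - 2 / 3| ≤ ε + 2 / (3 * cycleLength C)) := by
  refine ⟨fun n C hC φ₀ hφ => ⟨numSingle_add_numCnot C, card_qubit C hC, card_termLabel C,
      fun i => ⟨isStarProjection_term C i, isLocal_term C i⟩, star_historyState_dotProduct C hC hφ,
      term_mulVec_historyState C φ₀, ?_, fun v hv => hamiltonian_mulVec_mem C φ₀ hv,
      fun v hv => orthogonal_hamiltonian_mulVec C φ₀ hv, star_legalState_dotProduct C φ₀ hφ,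
      exists_equiv_adjMatrix C hC φ₀, fun τ => ?_, continuous_successProbability hC hφ⟩,
    ⟨4, by norm_num, fun n C hC φ₀ hφ T hT => averageSuccess_bounds hC hφ hT⟩,
    fun ε hε => ⟨4 / ε, by positivity,
      fun n C hC φ₀ hφ T hT => abs_averageSuccess_sub_le hC hφ hε hT⟩⟩
  · rw [startState_eq_legalState]
    exact legalState_mem C φ₀ _
  · have := neZero_cycleLength hC
    exact exists_evolved_eq_mul C hC φ₀ τ
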